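/- Let $\mathbb{C}\{x,y\}$ be the ring of power series in $x,y$ with complex coefficients that converge in some neighborhood of $(0,0)\in\mathbb{C}^2$. For $t\in\mathbb{C}$ let $X_t=\{(x,y)\in\mathbb{C}^2 : xy=t\}$, and let $dV_t$ be the volume (area) form on the smooth locus of $X_t$ induced by the Euclidean metric of $\mathbb{C}^2$. For $R>0$ let $D_0(R,R)=\{(x,y)\in\mathbb{C}^2 : |x|<R,\ |y|<R\}$. For $F\in\mathbb{C}\{x,y\}$ (not necessarily irreducible) write $f_t=F|_{X_t}$ where $F$ converges, and let $$c_0(f_0)=\sup\Big\{c\ge 0 : \int_{V}|f_0|^{-2c}\,dV_0<+\infty \text{ for some open neighborhood } V\subset X_0 \text{ of } (0,0)\Big\}\in[0,+\infty]$$ be the complex singularity exponent of $f_0$ at the origin (for $c>0$, $|f_0|^{-2c}=+\infty$ where $f_0=0$). Then for every $F\in\mathbb{C}\{x,y\}$ and every real $c$ with $0<c<c_0(f_0)$ there exist $R>0$, such that $F$ converges on $U=D_0(R,R)$, and constants $\delta>0$ and $M=M(R,F,c,\delta)>0$ such that, with $U_t=X_t\cap U$, $$\int_{U_t}\frac{dV_t}{|f_t|^{2c}}\le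 M\qquad\text{for all } t\in\mathbb{C} \text{ with } |t|\le\delta.$$ -/

import Mathlib

open MeasureTheory Filter Topology
open scoped ENNReal

noncomputable section

namespace FiberIntegral

/-- The term of the formal power series `F` in two variables with exponent `m = (m₀, m₁)`,
evaluated at the point `p = (x, y)`, that is `aₘ x ^ m₀ y ^ m₁`. -/
def term (F : MvPowerSeries (Fin 2) ℂ) (p : ℂ × ℂ) (m : Fin 2 →₀ ℕ) : ℂ :=
  MvPowerSeries.coeff m F * p.1 ^ m 0 * p.2 ^ m 1

/-- `F` belongs to `ℂ{x, y}`: it converges at every point of some neighbourhood of the origin. -/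
def IsConvergent (F : MvPowerSeries (Fin 2) ℂ) : Prop :=
  ∀ᶠ p in 𝓝 (0 : ℂ × ℂ), Summable (term F p)

/-- The sum of the power series `F` at the point `p` (meaningful where the series converges). -/
def evalAt (F : MvPowerSeries (Fin 2) ℂ) (p : ℂ × ℂ) : ℂ :=
  ∑' m, term F p m

/-- The open polydisc `D₀(R, R)` in `ℂ²`. -/
def polydisc (R : ℝ) : Set (ℂ × ℂ) :=
  {p | ‖p.1‖ < R ∧ ‖p.2‖ < R}

/-- The fibre `X_t = {(x, y) : x y = t}`. -/
def fiber (t : ℂ) : Set (ℂ × ℂ) :=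
  {p | p.1 * p.2 = t}

/-- The Euclidean (Riemannian) metric of `ℂ² = ℝ⁴`, the real part of `dx ⊗ dx̄ + dy ⊗ dȳ`. -/
def metric (u v : ℂ × ℂ) : ℝ :=
  inner ℝ u.1 v.1 + inner ℝ u.2 v.2

/-- The Riemannian area density `√(det g)` of the metric induced by `ℂ²`, in the real coordinates
`z = a + i b` of a parametrization `φ`. -/
def areaDensity (φ : ℂ → ℂ × ℂ) (z : ℂ) : ℝ :=
  Real.sqrt
    (metric (fderiv ℝ φ z 1) (fderiv ℝ φ z 1) *
        metric (fderiv ℝ φ z Complex.I) (fderiv ℝ φ z Complex.I) -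
      metric (fderiv ℝ φ z 1) (fderiv ℝ φ z Complex.I) ^ 2)

/-- The Riemannian area measure, for the metric induced by `ℂ²`, of the embedded surface
parametrized by `φ` on `ℂ \ {0}`, as a measure on `ℂ²`. -/
def areaMeasure (φ : ℂ → ℂ × ℂ) : Measure (ℂ × ℂ) :=
  (((volume : Measure ℂ).restrict {0}ᶜ).withDensity
    (fun z => ENNReal.ofReal (areaDensity φ z))).map φ

open Classical in
/-- The measure `dV_t`: the Riemannian area of the smooth locus of `X_t`. For `t ≠ 0` the curve
`X_t` is smooth and is parametrized by `x ↦ (x, t / x)`, `x ≠ 0`; the smooth locus of `X_0`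
consists of the two punctured coordinate axes. -/
def fiberVolume (t : ℂ) : Measure (ℂ × ℂ) :=
  if t = 0 then areaMeasure (fun x => (x, 0)) + areaMeasure (fun y => (0, y))
  else areaMeasure (fun x => (x, t / x))

/-- The integral `∫_S |f|^{-2c} dμ` in `[0, ∞]`; for `c > 0` the integrand is `∞` at the zeros
of `f`. -/
def negPowIntegral (μ : Measure (ℂ × ℂ)) (S : Set (ℂ × ℂ)) (f : ℂ × ℂ → ℂ) (c : ℝ) : ℝ≥0∞ :=
  ∫⁻ p in S, ‖f p‖ₑ ^ (-(2 * c)) ∂μ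

/-- The complex singularity exponent at `p` of (the germ at `p` of) `f` on the fibre `X_t`:
the supremum in `[0, ∞]` of all real `c ≥ 0` such that `|f|^{-2c}` has finite integral over some
open neighbourhood of `p` in `X_t`. -/
def singularityExponent (t : ℂ) (f : ℂ × ℂ → ℂ) (p : ℂ × ℂ) : ℝ≥0∞ :=
  sSup {e | ∃ c : ℝ, 0 ≤ c ∧ e = ENNReal.ofReal c ∧
    ∃ V : Set (ℂ × ℂ), IsOpen V ∧ p ∈ V ∧
      negPowIntegral (fiberVolume t) (fiber t ∩ V) f c < ⊤}

end FiberIntegral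

end

/-!
Write `F = ∑ a (m, n) x ^ m y ^ n`. Integrability of `|F| ^ (-2 c')` on `x y = 0` for some
`c' > c` provides nonzero coefficients `a (p, 0)` and `a (0, q)` with `c p < 1` and `c q < 1`
(`exists_coeff_ne_zero`). On a smooth fibre `x y = t`, with area form `(1 + |t|² / |x|⁴) dA(x)` in
the coordinate `x`, everything follows from a scale-invariant estimate near a point `(x, y)` close
to the origin, in the coordinate `u ↦ (x u, y / u)` with `u` near `1`.

There `u ^ q F(x u, y / u)` is, up to a relatively small error, a polynomial of degree `p + q` in
`u` (`norm_doubleSum_sub_le`) whose largest coefficient `N` is at least a multiple of `|x| ^ p`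
and of `|y| ^ q` (`eventually_le_norm_coeffVec`). Its coefficients are of the form `x ^ k A_k(t)`
and `y ^ k B_k(t)` with `A_k`, `B_k` analytic. Since orders of vanishing at `t = 0` are integers
and `t = x y` with `x` and `y` both small, two consecutive coefficients are never comparable
(`eventually_min_coeffVec_le`). So in the limit at most every second coefficient is nonzero; a
polynomial with `s` monomials has no nonzero root of multiplicity `s` or more
(`lt_card_support_of_pow_dvd`), hence `u = 1` is a root of multiplicity at most
`(p + q) / 2 ≤ max p q`. By compactness some Taylor coefficient of order `j ≤ (p + q) / 2` at `1` is bounded below by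
a multiple of `N` (`exists_le_sum_norm_sum_choose`).

A Cauchy integral for divided differences then shows that `j + 1` points of a sublevel set cannot
be far apart. The sublevel set is therefore covered by `j` small discs
(`exists_volume_sublevel_le`), and since `c j < 1` the integral of `|F| ^ (-2 c)` near `(x, y)` is
at most a multiple of `N ^ (-2 c)` (`exists_lintegral_ball_le`). On shells dyadic in `max |x| |y|`
this gives a convergent geometric series, because `2 - 2 c p > 0` and `2 - 2 c q > 0`
(`exists_lintegral_fiber_le`).
-/

namespace FiberIntegral

/-! ### Sparse polynomials -/

open Polynomial in
/-- In characteristic zero, the multiplicity of `1` as a root of a polynomial is smaller than the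
number of its monomials: `X P' - k P`, with `k` the lowest exponent, has one monomial less and
loses at most one in multiplicity. -/
theorem lt_card_support_of_pow_dvd (n : ℕ) (P : ℂ[X]) (hP : P ≠ 0) (h : (X - C 1) ^ n ∣ P) :
    n < P.support.card := by
  induction n generalizing P with
  | zero => exact Finset.card_pos.2 (support_nonempty.2 hP)
  | succ n ih =>
    set k := P.natTrailingDegree with hk
    have hkmem : k ∈ P.support := natTrailingDegree_mem_support_of_nonzero hP
    set Q := X * derivative P - C (k : ℂ) * P with hQ
    have hcoeff : ∀ i, Q.coeff i = ((i : ℂ) - k) * P.coeff i := by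
      intro i
      rcases i with _ | i
      · simp [hQ]
      · simp only [hQ, coeff_sub, coeff_X_mul, coeff_derivative, coeff_C_mul]
        push_cast; ring
    have hsupp : Q.support = P.support.erase k := by
      ext i
      simp [hcoeff, sub_eq_zero]
    have hdvd : (X - C 1) ^ n ∣ Q := by
      refine dvd_sub (Dvd.dvd.mul_left ?_ _)
        (Dvd.dvd.mul_left ((pow_dvd_pow _ n.le_succ).trans h) _)
      simpa using pow_sub_one_dvd_derivative_of_pow_dvd h
    by_cases hQ0 : Q = 0
    · exfalso
      have hmon : P = monomial k (P.coeff k) := by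
        ext i
        rw [coeff_monomial]
        split_ifs with hi
        · rw [hi]
        · have := hcoeff i
          rw [hQ0, coeff_zero] at this
          rcases mul_eq_zero.1 this.symm with h1 | h1
          · exact absurd (by exact_mod_cast (sub_eq_zero.1 h1).symm) hi
          · exact h1
      have hroot : P.eval 1 = 0 := by
        have : (X - C 1 : ℂ[X]) ∣ P := (dvd_pow_self _ n.succ_ne_zero).trans h
        exact dvd_iff_isRoot.1 this
      rw [hmon, eval_monomial, one_pow, mul_one] at hroot
      exact mem_support_iff.1 hkmem hroot
    · have h1 := ih Q hQ0 hdvd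
      rw [hsupp, Finset.card_erase_of_mem hkmem] at h1
      omega

/-- A set of natural numbers at most `d` without two consecutive elements has at most
`d / 2 + 1` elements. -/
theorem card_le_of_no_consecutive {d : ℕ} {s : Finset ℕ} (hs : ∀ i ∈ s, i ≤ d)
    (h : ∀ i ∈ s, i + 1 ∉ s) : s.card ≤ d / 2 + 1 := by
  have := Finset.card_le_card_of_injOn (s := s) (t := Finset.range (d / 2 + 1)) (fun i => i / 2)
    (fun i hi => by
      have := hs i hi
      simp only [Finset.coe_range, Set.mem_Iio]
      omega)
    (fun i hi j hj hij => by
      by_contra hne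
      simp only at hij
      rcases lt_or_gt_of_ne hne with hlt | hlt
      · exact h i hi (by rwa [show i + 1 = j by omega])
      · exact h j hj (by rwa [show j + 1 = i by omega]))
  simpa using this

open Polynomial in
/-- A polynomial of degree at most `d` without two consecutive nonzero coefficients vanishes as
soon as its Taylor coefficients at `1` of order at most `d / 2` do. -/
theorem eq_zero_of_sum_choose_mul_eq_zero {d : ℕ} (h : Fin (d + 1) → ℂ)
    (hadj : ∀ i : Fin d, h i.castSucc = 0 ∨ h i.succ = 0)
    (hT : ∀ j ≤ d / 2, ∑ k : Fin (d + 1), ((k : ℕ).choose j : ℂ) * h k = 0) : h = 0 := by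
  set P : ℂ[X] := ∑ k : Fin (d + 1), monomial (k : ℕ) (h k) with hPdef
  have hc : ∀ k : Fin (d + 1), P.coeff k = h k := by
    intro k
    simp only [hPdef, finsetSum_coeff, coeff_monomial]
    rw [Finset.sum_eq_single k (fun j _ hj => if_neg fun e => hj (Fin.ext e)) (by simp), if_pos rfl]
  have hdeg : ∀ i, d < i → P.coeff i = 0 := by
    intro i hi
    simp only [hPdef, finsetSum_coeff, coeff_monomial]
    exact Finset.sum_eq_zero fun j _ => if_neg (by omega)
  by_contra hne
  have hP : P ≠ 0 := by
    intro hP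
    exact hne (funext fun k => by rw [← hc k, hP]; simp)
  have hdvd : (X - C 1) ^ (d / 2 + 1) ∣ P := by
    rw [X_sub_C_pow_dvd_iff, ← taylor_apply, X_pow_dvd_iff]
    intro j hj
    rw [taylor_coeff, hPdef, map_sum, eval_finsetSum, ← hT j (by omega)]
    refine Finset.sum_congr rfl fun k _ => ?_
    rw [hasseDeriv_monomial, eval_monomial, one_pow, mul_one]
  have h1 := lt_card_support_of_pow_dvd _ P hP hdvd
  have h2 : P.support.card ≤ d / 2 + 1 := by
    have hle : ∀ i ∈ P.support, i ≤ d := fun i hi => by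
      by_contra hlt
      exact mem_support_iff.1 hi (hdeg i (by omega))
    refine card_le_of_no_consecutive hle fun i hi hi1 => ?_
    have hid : i < d := hle _ hi1
    rcases hadj ⟨i, hid⟩ with h0 | h0
    · exact mem_support_iff.1 hi ((hc (Fin.castSucc ⟨i, hid⟩)).trans h0)
    · exact mem_support_iff.1 hi1 ((hc (Fin.succ ⟨i, hid⟩)).trans h0)
  omega

/-- Quantitative form of `eq_zero_of_sum_choose_mul_eq_zero`, for polynomials whose consecutive
coefficients are only comparatively small. Both sides are homogeneous in `h`, so compactness of
the unit sphere suffices. -/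
theorem exists_le_sum_norm_sum_choose (d : ℕ) : ∃ c₀ : ℝ, 0 < c₀ ∧ ∀ h : Fin (d + 1) → ℂ,
    c₀ * ‖h‖ ≤ ∑ j ∈ Finset.range (d / 2 + 1), ‖∑ k : Fin (d + 1), ((k : ℕ).choose j : ℂ) * h k‖ +
      ∑ i : Fin d, min ‖h i.castSucc‖ ‖h i.succ‖ := by
  set Φ : (Fin (d + 1) → ℂ) → ℝ := fun h =>
    ∑ j ∈ Finset.range (d / 2 + 1), ‖∑ k : Fin (d + 1), ((k : ℕ).choose j : ℂ) * h k‖ +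
      ∑ i : Fin d, min ‖h i.castSucc‖ ‖h i.succ‖ with hΦ
  have hcont : Continuous Φ := by fun_prop
  have hsphere : (Metric.sphere (0 : Fin (d + 1) → ℂ) 1).Nonempty :=
    ⟨fun _ => 1, by simp⟩
  obtain ⟨h₀, hh₀, hmin⟩ := (isCompact_sphere (0 : Fin (d + 1) → ℂ) 1).exists_isMinOn hsphere
    hcont.continuousOn
  have hA : ∀ h : Fin (d + 1) → ℂ, 0 ≤ ∑ j ∈ Finset.range (d / 2 + 1),
      ‖∑ k : Fin (d + 1), ((k : ℕ).choose j : ℂ) * h k‖ :=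
    fun h => Finset.sum_nonneg fun _ _ => norm_nonneg _
  have hB : ∀ h : Fin (d + 1) → ℂ, 0 ≤ ∑ i : Fin d, min ‖h i.castSucc‖ ‖h i.succ‖ :=
    fun h => Finset.sum_nonneg fun _ _ => le_min (norm_nonneg _) (norm_nonneg _)
  have hpos : 0 < Φ h₀ := by
    rcases (add_nonneg (hA h₀) (hB h₀)).lt_or_eq with h | h
    · exact h
    · exfalso
      have h1 := (add_eq_zero_iff_of_nonneg (hA h₀) (hB h₀)).1 h.symm
      have h2 := (Finset.sum_eq_zero_iff_of_nonneg fun _ _ => norm_nonneg _).1 h1.1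
      have h3 := (Finset.sum_eq_zero_iff_of_nonneg fun (i : Fin d) _ =>
        le_min (norm_nonneg (h₀ i.castSucc)) (norm_nonneg (h₀ i.succ))).1 h1.2
      have h4 : h₀ = 0 := by
        refine eq_zero_of_sum_choose_mul_eq_zero h₀ (fun i => ?_) fun j hj =>
          norm_eq_zero.1 (h2 j (Finset.mem_range.2 (by omega)))
        rcases min_choice ‖h₀ i.castSucc‖ ‖h₀ i.succ‖ with h5 | h5
        · exact Or.inl (norm_eq_zero.1 (h5.symm.trans (h3 i (Finset.mem_univ _))))
        · exact Or.inr (norm_eq_zero.1 (h5.symm.trans (h3 i (Finset.mem_univ _))))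
      rw [h4] at hh₀
      simp at hh₀
  refine ⟨Φ h₀, hpos, fun h => ?_⟩
  change Φ h₀ * ‖h‖ ≤ Φ h
  by_cases hh : h = 0
  · rw [hh, norm_zero, mul_zero]
    exact add_nonneg (hA _) (hB _)
  have hn : 0 < ‖h‖ := norm_pos_iff.2 hh
  have hscale : ∀ r : ℝ, 0 ≤ r → Φ ((r : ℂ) • h) = r * Φ h := by
    intro r hr
    have hr' : ‖(r : ℂ)‖ = r := by simp [abs_of_nonneg hr]
    simp only [hΦ, Pi.smul_apply, smul_eq_mul, norm_mul, hr', mul_add, Finset.mul_sum,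
      ← mul_min_of_nonneg _ _ hr]
    congr 1
    refine Finset.sum_congr rfl fun j _ => ?_
    rw [← hr', ← norm_mul, Finset.mul_sum, hr']
    congr 1
    exact Finset.sum_congr rfl fun k _ => by ring
  have hmem : (((‖h‖⁻¹ : ℝ) : ℂ) • h) ∈ Metric.sphere (0 : Fin (d + 1) → ℂ) 1 := by
    rw [mem_sphere_zero_iff_norm, norm_smul]
    simp [hn.ne']
  have := hmin hmem
  simp only [Set.mem_ofPred_eq] at this
  rw [hscale _ (inv_nonneg.2 hn.le), ← div_eq_inv_mul, le_div_iff₀ hn] at this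
  exact this

/-! ### Sublevel sets of holomorphic functions -/

/-- A divided difference as a contour integral: for distinct nodes inside the circle,
`H / ∏ (ζ - z)` integrates to the sum of its residues. -/
theorem circleIntegral_prod_inv_mul {H : ℂ → ℂ}
    (hH : DifferentiableOn ℂ H (Metric.ball 1 (1 / 2))) (s : Finset ℂ)
    (hs : ∀ z ∈ s, z ∈ Metric.ball (1 : ℂ) (1 / 4)) (hne : s.Nonempty) :
    ∮ ζ in C(1, 1 / 4), (∏ z ∈ s, (ζ - z)⁻¹) * H ζ =
      2 * Real.pi * Complex.I * ∑ z ∈ s, Lagrange.nodalWeight s id z * H z := by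
  have hsub : Metric.closedBall (1 : ℂ) (1 / 4) ⊆ Metric.ball 1 (1 / 2) :=
    Metric.closedBall_subset_ball (by norm_num)
  have hoff : ∀ ζ ∈ Metric.sphere (1 : ℂ) (1 / 4), ∀ z ∈ s, ζ ≠ z := by
    rintro ζ hζ z hz rfl
    exact (Metric.mem_ball.1 (hs _ hz)).ne (Metric.mem_sphere.1 hζ)
  have hcongr : ∀ ζ ∈ Metric.sphere (1 : ℂ) (1 / 4), (∏ z ∈ s, (ζ - z)⁻¹) * H ζ =
      ∑ z ∈ s, Lagrange.nodalWeight s id z * ((ζ - z)⁻¹ * H ζ) := by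
    intro ζ hζ
    have h1 := Lagrange.eval_interpolate_not_at_node (s := s) (v := id) (1 : ℂ → ℂ) (hoff ζ hζ)
    rw [Lagrange.interpolate_one (Function.injective_id.injOn) hne, Polynomial.eval_one,
      Lagrange.eval_nodal] at h1
    have h2 : (∏ z ∈ s, (ζ - z)) ≠ 0 :=
      Finset.prod_ne_zero_iff.2 fun z hz => sub_ne_zero.2 (hoff ζ hζ z hz)
    simp only [id, Pi.one_apply, mul_one] at h1
    simp only [← mul_assoc]
    rw [← Finset.sum_mul, Finset.prod_inv_distrib, eq_inv_of_mul_eq_one_right h1.symm]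
  have hr : (0 : ℝ) ≤ 1 / 4 := by norm_num
  rw [circleIntegral.integral_congr hr hcongr, circleIntegral.integral_fun_sum, Finset.mul_sum]
  · refine Finset.sum_congr rfl fun z hz => ?_
    rw [circleIntegral.integral_const_mul]
    have hd : DiffContOnCl ℂ H (Metric.ball 1 (1 / 4)) :=
      hH.diffContOnCl_ball hsub
    have := hd.circleIntegral_sub_inv_smul (hs z hz)
    simp only [smul_eq_mul] at this
    rw [this]
    ring
  · intro z hz
    refine ContinuousOn.circleIntegrable hr ?_
    refine continuousOn_const.mul (ContinuousOn.mul (ContinuousOn.inv₀ (by fun_prop) ?_) ?_)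
    · exact fun ζ hζ => sub_ne_zero.2 (hoff ζ hζ z hz)
    · exact hH.continuousOn.mono (Metric.sphere_subset_closedBall.trans hsub)

theorem norm_prod_sub_pow_le (s : Finset ℂ) (f : ℂ → ℂ) (g : ℂ) {M δ : ℝ} (hM : 1 ≤ M)
    (hδ : 0 ≤ δ) (hf : ∀ z ∈ s, ‖f z‖ ≤ M) (hg : ‖g‖ ≤ M) (hfg : ∀ z ∈ s, ‖f z - g‖ ≤ δ) :
    ‖∏ z ∈ s, f z - g ^ s.card‖ ≤ s.card * M ^ s.card * δ := by
  induction s using Finset.induction_on with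
  | empty => simp
  | insert a s ha ih =>
    have ih' := ih (fun z hz => hf z (Finset.mem_insert_of_mem hz))
      (fun z hz => hfg z (Finset.mem_insert_of_mem hz))
    rw [Finset.prod_insert ha, Finset.card_insert_of_notMem ha]
    have e : f a * ∏ z ∈ s, f z - g ^ (s.card + 1) =
        f a * (∏ z ∈ s, f z - g ^ s.card) + (f a - g) * g ^ s.card := by ring
    have hMn : (0 : ℝ) ≤ M ^ s.card := by positivity
    calc ‖f a * ∏ z ∈ s, f z - g ^ (s.card + 1)‖
        ≤ ‖f a‖ * ‖∏ z ∈ s, f z - g ^ s.card‖ + ‖f a - g‖ * ‖g‖ ^ s.card := by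
          rw [e]
          refine (norm_add_le _ _).trans ?_
          rw [norm_mul, norm_mul, norm_pow]
      _ ≤ M * (s.card * M ^ s.card * δ) + δ * M ^ s.card := by
          gcongr
          · exact hf a (Finset.mem_insert_self _ _)
          · exact hfg a (Finset.mem_insert_self _ _)
      _ ≤ M * (s.card * M ^ s.card * δ) + M * (δ * M ^ s.card) := by
          refine add_le_add le_rfl ?_
          exact le_mul_of_one_le_left (by positivity : 0 ≤ δ * M ^ s.card) hM
      _ = ((s.card + 1 : ℕ) : ℝ) * M ^ (s.card + 1) * δ := by push_cast; ring

/-- If a Taylor coefficient of order `j` of a bounded holomorphic function is bounded below, so are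
its divided differences of order `j` at nodes close to the centre. -/
theorem exists_le_sum_norm_nodalWeight_mul (J : ℕ) {K c₁ : ℝ} (hK : 0 < K) (hc₁ : 0 < c₁) :
    ∃ ρ : ℝ, 0 < ρ ∧ ρ ≤ 1 / 8 ∧ ∀ H : ℂ → ℂ, DifferentiableOn ℂ H (Metric.ball 1 (1 / 2)) →
      (∀ ζ ∈ Metric.sphere (1 : ℂ) (1 / 4), ‖H ζ‖ ≤ K) → ∀ j ≤ J,
      c₁ ≤ ‖∮ ζ in C(1, 1 / 4), ((ζ - 1)⁻¹) ^ (j + 1) * H ζ‖ →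
      ∀ s : Finset ℂ, s.card = j + 1 → (∀ z ∈ s, z ∈ Metric.ball (1 : ℂ) ρ) →
        c₁ / (4 * Real.pi) ≤ ∑ z ∈ s, ‖Lagrange.nodalWeight s id z‖ * ‖H z‖ := by
  have hpi := Real.pi_pos
  set B : ℝ := 2 * Real.pi * (1 / 4) * (((J + 1) * 8 ^ (J + 1) * 32) * K) with hB
  have hBpos : 0 < B := by positivity
  refine ⟨min (1 / 8) (c₁ / 2 / B), by positivity, min_le_left _ _, ?_⟩
  set ρ := min (1 / 8) (c₁ / 2 / B) with hρ
  have hρ8 : ρ ≤ 1 / 8 := min_le_left _ _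
  have hρ0 : 0 < ρ := by positivity
  have hρB : B * ρ ≤ c₁ / 2 := by
    have : ρ ≤ c₁ / 2 / B := min_le_right _ _
    rwa [le_div_iff₀' hBpos] at this
  intro H hH hHK j hj hlow s hcard hs
  have hs4 : ∀ z ∈ s, z ∈ Metric.ball (1 : ℂ) (1 / 4) := fun z hz =>
    Metric.ball_subset_ball (by linarith) (hs z hz)
  have hr : (0 : ℝ) ≤ 1 / 4 := by norm_num
  have hHc : ContinuousOn H (Metric.sphere 1 (1 / 4)) := hH.continuousOn.mono
    (Metric.sphere_subset_closedBall.trans (Metric.closedBall_subset_ball (by norm_num)))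
  have hfar : ∀ ζ ∈ Metric.sphere (1 : ℂ) (1 / 4), ∀ z ∈ s, 1 / 8 ≤ ‖ζ - z‖ := by
    intro ζ hζ z hz
    have h1 : ‖ζ - 1‖ = 1 / 4 := mem_sphere_iff_norm.1 hζ
    have h2 : ‖z - 1‖ < ρ := mem_ball_iff_norm.1 (hs z hz)
    have h3 := norm_sub_norm_le (ζ - 1) (z - 1)
    rw [sub_sub_sub_cancel_right] at h3
    linarith
  have hbound : ∀ ζ ∈ Metric.sphere (1 : ℂ) (1 / 4),
      ‖(∏ z ∈ s, (ζ - z)⁻¹) * H ζ - ((ζ - 1)⁻¹) ^ (j + 1) * H ζ‖ ≤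
        ((J + 1) * 8 ^ (J + 1) * (32 * ρ)) * K := by
    intro ζ hζ
    have h1 : ‖ζ - 1‖ = 1 / 4 := mem_sphere_iff_norm.1 hζ
    have hprod := norm_prod_sub_pow_le s (fun z => (ζ - z)⁻¹) (ζ - 1)⁻¹ (M := 8) (δ := 32 * ρ)
      (by norm_num) (by positivity)
      (fun z hz => by
        rw [norm_inv]
        exact inv_le_of_inv_le₀ (by norm_num) (by simpa using hfar ζ hζ z hz))
      (by rw [norm_inv, h1]; norm_num)
      (fun z hz => by
        have h2 := hfar ζ hζ z hz
        have h3 : ‖z - 1‖ < ρ := mem_ball_iff_norm.1 (hs z hz)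
        have h4 : ζ - z ≠ 0 := norm_pos_iff.1 (by linarith)
        have h5 : ζ - 1 ≠ 0 := norm_pos_iff.1 (by linarith)
        rw [inv_sub_inv h4 h5, norm_div, norm_mul, h1, div_le_iff₀ (by positivity)]
        rw [show ζ - 1 - (ζ - z) = z - 1 by ring]
        nlinarith)
    rw [← sub_mul, norm_mul]
    rw [hcard] at hprod
    refine mul_le_mul (hprod.trans ?_) (hHK ζ hζ) (norm_nonneg _) (by positivity)
    have hjJ : ((j + 1 : ℕ) : ℝ) ≤ J + 1 := by exact_mod_cast Nat.succ_le_succ hj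
    gcongr
    · norm_num
  have hclose : ‖(∮ ζ in C(1, 1 / 4), (∏ z ∈ s, (ζ - z)⁻¹) * H ζ) -
      ∮ ζ in C(1, 1 / 4), ((ζ - 1)⁻¹) ^ (j + 1) * H ζ‖ ≤ c₁ / 2 := by
    rw [← circleIntegral.integral_sub]
    · refine (circleIntegral.norm_integral_le_of_norm_le_const hr hbound).trans ?_
      refine le_trans (le_of_eq ?_) hρB
      rw [hB]; ring
    · refine ContinuousOn.circleIntegrable hr (ContinuousOn.mul ?_ hHc)
      refine continuousOn_finsetProd _ fun z hz => ContinuousOn.inv₀ (by fun_prop) fun ζ hζ => ?_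
      exact norm_pos_iff.1 (by linarith [hfar ζ hζ z hz])
    · refine ContinuousOn.circleIntegrable hr (ContinuousOn.mul ?_ hHc)
      refine (ContinuousOn.inv₀ (by fun_prop) fun ζ hζ => ?_).pow _
      exact norm_pos_iff.1 (by rw [mem_sphere_iff_norm.1 hζ]; norm_num)
  rw [circleIntegral_prod_inv_mul hH s hs4 (Finset.card_pos.1 (by omega))] at hclose
  have h1 : c₁ / 2 ≤ ‖2 * Real.pi * Complex.I * ∑ z ∈ s, Lagrange.nodalWeight s id z * H z‖ := by
    have := norm_sub_norm_le (∮ ζ in C(1, 1 / 4), ((ζ - 1)⁻¹) ^ (j + 1) * H ζ)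
      (2 * Real.pi * Complex.I * ∑ z ∈ s, Lagrange.nodalWeight s id z * H z)
    rw [norm_sub_rev] at this
    linarith
  have h2 : ‖(2 * Real.pi * Complex.I : ℂ)‖ = 2 * Real.pi := by
    simp [abs_of_pos hpi]
  rw [norm_mul, h2] at h1
  have h3 : ‖∑ z ∈ s, Lagrange.nodalWeight s id z * H z‖ ≤
      ∑ z ∈ s, ‖Lagrange.nodalWeight s id z‖ * ‖H z‖ :=
    (norm_sum_le _ _).trans (le_of_eq (Finset.sum_congr rfl fun z _ => norm_mul _ _))
  rw [div_le_iff₀ (by positivity)]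
  nlinarith

/-- A planar set without `n + 1` points at mutual distance at least `d` is covered by `n` discs of
radius `d`. -/
theorem volume_le_of_card_separated_le {d : ℝ} (hd : 0 < d) (n : ℕ) (A : Set ℂ)
    (hA : ∀ s : Finset ℂ, (∀ z ∈ s, z ∈ A) → (∀ z ∈ s, ∀ w ∈ s, z ≠ w → d ≤ ‖z - w‖) →
      s.card ≤ n) :
    volume A ≤ n * (ENNReal.ofReal d ^ 2 * NNReal.pi) := by
  induction n generalizing A with
  | zero =>
    have : A = ∅ := by
      by_contra hne
      obtain ⟨a, ha⟩ := Set.nonempty_iff_ne_empty.2 hne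
      have := hA {a} (by simpa using ha) (by simp)
      simp at this
    simp [this]
  | succ n ih =>
    rcases A.eq_empty_or_nonempty with rfl | ⟨a, ha⟩
    · simp
    have h1 : volume (A \ Metric.ball a d) ≤ n * (ENNReal.ofReal d ^ 2 * NNReal.pi) := by
      refine ih _ fun s hs hsep => ?_
      have has : a ∉ s := fun has => (hs a has).2 (Metric.mem_ball_self hd)
      have h2 := hA (insert a s) (fun z hz => by
            rcases Finset.mem_insert.1 hz with rfl | hz
            · exact ha
            · exact (hs z hz).1)
          (fun z hz w hw hzw => by
            have hfar : ∀ z ∈ s, d ≤ ‖z - a‖ := fun z hz => by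
              have := (hs z hz).2
              rw [mem_ball_iff_norm] at this
              exact not_lt.1 this
            rcases Finset.mem_insert.1 hz with hza | hza <;>
              rcases Finset.mem_insert.1 hw with hwa | hwa
            · exact absurd (hza.trans hwa.symm) hzw
            · rw [hza, norm_sub_rev]; exact hfar w hwa
            · rw [hwa]; exact hfar z hza
            · exact hsep z hza w hwa hzw)
      rw [Finset.card_insert_of_notMem has] at h2
      omega
    calc volume A ≤ volume (Metric.ball a d ∪ A \ Metric.ball a d) := by
          apply measure_mono
          intro z hz
          by_cases hzb : z ∈ Metric.ball a d
          · exact Or.inl hzb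
          · exact Or.inr ⟨hz, hzb⟩
      _ ≤ volume (Metric.ball a d) + volume (A \ Metric.ball a d) := measure_union_le _ _
      _ ≤ ENNReal.ofReal d ^ 2 * NNReal.pi + n * (ENNReal.ofReal d ^ 2 * NNReal.pi) := by
          rw [Complex.volume_ball]
          gcongr
      _ = (n + 1 : ℕ) * (ENNReal.ofReal d ^ 2 * NNReal.pi) := by push_cast; ring

/-- A bounded holomorphic function with a Taylor coefficient of order `j ≤ κ` bounded below has
sublevel sets of area `O(lam ^ (2 / κ))`: by the estimate on divided differences, `j + 1` points of
the sublevel set cannot be far apart. -/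
theorem exists_volume_sublevel_le {K c₁ κ : ℝ} (hK : 0 < K) (hc₁ : 0 < c₁) (hκ : 0 < κ) :
    ∃ ρ C : ℝ, 0 < ρ ∧ ρ ≤ 1 / 8 ∧ 0 ≤ C ∧
      ∀ H : ℂ → ℂ, DifferentiableOn ℂ H (Metric.ball 1 (1 / 2)) →
      (∀ ζ ∈ Metric.sphere (1 : ℂ) (1 / 4), ‖H ζ‖ ≤ K) → ∀ j : ℕ, (j : ℝ) ≤ κ →
      c₁ ≤ ‖∮ ζ in C(1, 1 / 4), ((ζ - 1)⁻¹) ^ (j + 1) * H ζ‖ → ∀ lam : ℝ, 0 < lam →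
        volume {u | u ∈ Metric.ball (1 : ℂ) ρ ∧ ‖H u‖ ≤ lam} ≤
          ENNReal.ofReal (C * lam ^ (2 / κ)) := by
  set J := ⌊κ⌋₊ with hJ
  obtain ⟨ρ, hρ0, hρ8, hmain⟩ := exists_le_sum_norm_nodalWeight_mul J hK hc₁
  have hpi := Real.pi_pos
  set b := c₁ / (4 * Real.pi) with hb
  have hb0 : 0 < b := by positivity
  refine ⟨ρ, (J + 1) * (((J + 2) / b) ^ (2 / κ) * Real.pi), hρ0, hρ8, by positivity, ?_⟩
  intro H hH hHK j hj hlow lam hlam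
  have hjJ : j ≤ J := Nat.le_floor hj
  have hjJ' : (j : ℝ) ≤ J := by exact_mod_cast hjJ
  set A := {u | u ∈ Metric.ball (1 : ℂ) ρ ∧ ‖H u‖ ≤ lam} with hA
  set D : ℝ := (J + 2) / b * lam with hD
  have hD0 : 0 < D := by positivity
  -- the separation for which `j + 1` points of the sublevel set contradict the lower bound `b`
  set d : ℝ := D ^ (1 / κ) with hd
  have hd0 : 0 < d := by positivity
  have hdκ : d ^ κ = D := by
    rw [hd, ← Real.rpow_mul hD0.le, one_div_mul_cancel hκ.ne', Real.rpow_one]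
  have hd2 : d ^ 2 = ((J + 2) / b) ^ (2 / κ) * lam ^ (2 / κ) := by
    rw [← Real.mul_rpow (by positivity) hlam.le, ← hD, hd, ← Real.rpow_natCast,
      ← Real.rpow_mul hD0.le]
    congr 1
    push_cast; ring
  have htarget : ENNReal.ofReal ((J + 1) * (((J + 2) / b) ^ (2 / κ) * Real.pi) * lam ^ (2 / κ)) =
      ((J + 1 : ℕ) : ℝ≥0∞) * (ENNReal.ofReal d ^ 2 * NNReal.pi) := by
    rw [← ENNReal.ofReal_pow hd0.le, ← ENNReal.ofReal_coe_nnreal (p := NNReal.pi),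
      NNReal.coe_real_pi, ← ENNReal.ofReal_mul (by positivity), ← ENNReal.ofReal_natCast,
      ← ENNReal.ofReal_mul (by positivity), hd2]
    congr 1
    push_cast; ring
  rw [htarget]
  rcases le_or_gt d 1 with hd1 | hd1
  · have hcov : volume A ≤ j * (ENNReal.ofReal d ^ 2 * NNReal.pi) := by
      refine volume_le_of_card_separated_le hd0 j A fun s hs hsep => ?_
      by_contra hcard
      obtain ⟨s', hs's, hs'card⟩ := Finset.exists_subset_card_eq (s := s) (n := j + 1) (by omega)
      have h1 := hmain H hH hHK j hjJ hlow s' hs'card fun z hz => (hs z (hs's hz)).1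
      have h2 : ∀ z ∈ s', ‖Lagrange.nodalWeight s' id z‖ * ‖H z‖ ≤ D⁻¹ * lam := by
        intro z hz
        refine mul_le_mul ?_ (hs z (hs's hz)).2 (norm_nonneg _) (by positivity)
        have h3 : ‖Lagrange.nodalWeight s' id z‖ ≤ d⁻¹ ^ j := by
          rw [Lagrange.nodalWeight, norm_prod]
          refine (Finset.prod_le_prod (g := fun _ => d⁻¹) (fun _ _ => norm_nonneg _)
            fun w hw => ?_).trans_eq ?_
          · rw [norm_inv]
            have hw' := Finset.mem_erase.1 hw
            exact inv_anti₀ hd0 (hsep z (hs's hz) w (hs's hw'.2) hw'.1.symm)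
          · rw [Finset.prod_const, Finset.card_erase_of_mem hz, hs'card, Nat.add_sub_cancel]
        refine h3.trans ?_
        rw [inv_pow]
        refine inv_anti₀ hD0 ?_
        rw [← hdκ, ← Real.rpow_natCast]
        exact Real.rpow_le_rpow_of_exponent_ge hd0 hd1 hj
      have h4 := h1.trans (Finset.sum_le_card_nsmul _ _ _ h2)
      rw [hs'card, nsmul_eq_mul] at h4
      have h5 : ((j + 1 : ℕ) : ℝ) * (D⁻¹ * lam) = (j + 1) / (J + 2) * b := by
        rw [hD]; push_cast; field_simp
      rw [h5] at h4
      have h6 : ((j : ℝ) + 1) / (J + 2) < 1 := by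
        rw [div_lt_one (by positivity)]; linarith
      nlinarith
    refine hcov.trans ?_
    gcongr
    omega
  · calc volume A ≤ volume (Metric.ball (1 : ℂ) ρ) := measure_mono fun u hu => hu.1
      _ = ENNReal.ofReal ρ ^ 2 * NNReal.pi := Complex.volume_ball _ _
      _ ≤ ENNReal.ofReal d ^ 2 * NNReal.pi := by
          gcongr
          linarith
      _ ≤ ((J + 1 : ℕ) : ℝ≥0∞) * (ENNReal.ofReal d ^ 2 * NNReal.pi) :=
          le_mul_of_one_le_left' (by exact_mod_cast Nat.succ_pos J)

/-- For `a < 0` the power `‖z‖ ^ a` is antitone in `‖z‖`. -/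
theorem enorm_rpow_le_of_le_norm {z : ℂ} {r a : ℝ} (hr : 0 < r) (ha : a ≤ 0) (h : r ≤ ‖z‖) :
    ‖z‖ₑ ^ a ≤ ENNReal.ofReal (r ^ a) := by
  rw [← ofReal_norm, ENNReal.ofReal_rpow_of_pos (hr.trans_le h)]
  exact ENNReal.ofReal_le_ofReal (Real.rpow_le_rpow_of_nonpos hr h ha)

/-- Layer cake estimate: sublevel sets of measure `O(lam ^ α)` make `|g| ^ (-2 c)` integrable for
`2 c < α`, with a bound that depends on the constants only. -/
theorem exists_lintegral_le_of_sublevel_le {C α c : ℝ} {V : ℝ≥0∞} (hC : 0 ≤ C) (hc : 0 < c)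
    (hα : 2 * c < α) (hV : V ≠ ⊤) :
    ∃ M : ℝ≥0∞, M ≠ ⊤ ∧ ∀ (S : Set ℂ) (g : ℂ → ℂ), volume S ≤ V →
      (∀ lam : ℝ, 0 < lam → volume {u | u ∈ S ∧ ‖g u‖ ≤ lam} ≤ ENNReal.ofReal (C * lam ^ α)) →
      ∫⁻ u in S, ‖g u‖ₑ ^ (-(2 * c)) ≤ M := by
  set a : ℕ → ℝ := fun n => ((1 / 2 : ℝ) ^ (n + 1)) ^ (-(2 * c)) * (C * ((1 / 2 : ℝ) ^ n) ^ α)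
    with ha
  have hform : a = fun n => C * (1 / 2 : ℝ) ^ (-(2 * c)) * ((1 / 2 : ℝ) ^ (α - 2 * c)) ^ n := by
    funext n
    have hh : (0 : ℝ) < 1 / 2 := by norm_num
    simp only [ha]
    rw [← Real.rpow_natCast, ← Real.rpow_natCast, ← Real.rpow_natCast, ← Real.rpow_mul hh.le,
      ← Real.rpow_mul hh.le, ← Real.rpow_mul hh.le, mul_left_comm, mul_assoc, ← Real.rpow_add hh,
      ← Real.rpow_add hh]
    congr 2
    push_cast; ring
  have hasum : Summable a := by
    rw [hform]
    refine (summable_geometric_of_lt_one (by positivity) ?_).mul_left _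
    exact Real.rpow_lt_one (by norm_num) (by norm_num) (by linarith)
  have ha0 : ∀ n, 0 ≤ a n := fun n => by simp only [ha]; positivity
  refine ⟨V + ∑' n, ENNReal.ofReal (a n), ENNReal.add_ne_top.2 ⟨hV, ?_⟩, ?_⟩
  · rw [← ENNReal.ofReal_tsum_of_nonneg ha0 hasum]
    exact ENNReal.ofReal_ne_top
  intro S g hSV hsub
  set S₁ := {u | u ∈ S ∧ 1 ≤ ‖g u‖}
  set S₀ := {u | u ∈ S ∧ ‖g u‖ = 0}
  set T : ℕ → Set ℂ := fun n => {u | u ∈ S ∧ (1 / 2 : ℝ) ^ (n + 1) < ‖g u‖ ∧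
    ‖g u‖ ≤ (1 / 2 : ℝ) ^ n}
  have hcov : S ⊆ S₁ ∪ (S₀ ∪ ⋃ n, T n) := by
    intro u hu
    rcases le_or_gt 1 ‖g u‖ with h1 | h1
    · exact Or.inl ⟨hu, h1⟩
    rcases (norm_nonneg (g u)).eq_or_lt with h0 | h0
    · exact Or.inr (Or.inl ⟨hu, h0.symm⟩)
    obtain ⟨n, hn1, hn2⟩ := exists_nat_pow_near_of_lt_one h0 h1.le
      (by norm_num : (0 : ℝ) < 1 / 2) (by norm_num)
    exact Or.inr (Or.inr (Set.mem_iUnion.2 ⟨n, hu, hn1, hn2⟩))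
  have hneg : -(2 * c) ≤ 0 := by linarith
  have hS₁ : ∫⁻ u in S₁, ‖g u‖ₑ ^ (-(2 * c)) ≤ V := by
    calc ∫⁻ u in S₁, ‖g u‖ₑ ^ (-(2 * c)) ≤ ∫⁻ _ in S₁, 1 := by
          refine setLIntegral_mono measurable_const fun u hu => ?_
          simpa using enorm_rpow_le_of_le_norm one_pos hneg hu.2
      _ = volume S₁ := setLIntegral_one _
      _ ≤ V := (measure_mono fun u hu => hu.1).trans hSV
  have hS₀ : ∫⁻ u in S₀, ‖g u‖ₑ ^ (-(2 * c)) = 0 := by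
    refine setLIntegral_measure_zero _ _ (le_antisymm ?_ bot_le)
    have hlim : Tendsto (fun lam : ℝ => ENNReal.ofReal (C * lam ^ α)) (𝓝[>] 0) (𝓝 0) := by
      have hcont : Continuous fun lam : ℝ => ENNReal.ofReal (C * lam ^ α) :=
        ENNReal.continuous_ofReal.comp
          (continuous_const.mul (Real.continuous_rpow_const (by linarith)))
      have := (hcont.tendsto 0).mono_left (nhdsWithin_le_nhds (s := Set.Ioi 0))
      rwa [Real.zero_rpow (by linarith), mul_zero, ENNReal.ofReal_zero] at this
    refine ge_of_tendsto hlim ?_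
    filter_upwards [self_mem_nhdsWithin] with lam hlam
    exact (measure_mono fun u (hu : u ∈ S₀) => (⟨hu.1, hu.2.le.trans (le_of_lt hlam)⟩ :
      u ∈ {u | u ∈ S ∧ ‖g u‖ ≤ lam})).trans (hsub lam hlam)
  have hT : ∀ n, ∫⁻ u in T n, ‖g u‖ₑ ^ (-(2 * c)) ≤ ENNReal.ofReal (a n) := by
    intro n
    have hp : (0 : ℝ) < (1 / 2 : ℝ) ^ (n + 1) := by positivity
    calc ∫⁻ u in T n, ‖g u‖ₑ ^ (-(2 * c))
        ≤ ∫⁻ _ in T n, ENNReal.ofReal (((1 / 2 : ℝ) ^ (n + 1)) ^ (-(2 * c))) :=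
          setLIntegral_mono measurable_const fun u hu =>
            enorm_rpow_le_of_le_norm hp hneg hu.2.1.le
      _ = ENNReal.ofReal (((1 / 2 : ℝ) ^ (n + 1)) ^ (-(2 * c))) * volume (T n) :=
          setLIntegral_const _ _
      _ ≤ ENNReal.ofReal (((1 / 2 : ℝ) ^ (n + 1)) ^ (-(2 * c))) *
            ENNReal.ofReal (C * ((1 / 2 : ℝ) ^ n) ^ α) := by
          gcongr
          exact (measure_mono fun u (hu : u ∈ T n) => (⟨hu.1, hu.2.2⟩ :
            u ∈ {u | u ∈ S ∧ ‖g u‖ ≤ (1 / 2 : ℝ) ^ n})).trans (hsub _ (by positivity))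
      _ = ENNReal.ofReal (a n) := (ENNReal.ofReal_mul (by positivity)).symm
  calc ∫⁻ u in S, ‖g u‖ₑ ^ (-(2 * c))
      ≤ ∫⁻ u in S₁ ∪ (S₀ ∪ ⋃ n, T n), ‖g u‖ₑ ^ (-(2 * c)) := lintegral_mono_set hcov
    _ ≤ (∫⁻ u in S₁, ‖g u‖ₑ ^ (-(2 * c))) + ((∫⁻ u in S₀, ‖g u‖ₑ ^ (-(2 * c))) +
          ∫⁻ u in ⋃ n, T n, ‖g u‖ₑ ^ (-(2 * c))) :=
        (lintegral_union_le _ _ _).trans (add_le_add le_rfl (lintegral_union_le _ _ _))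
    _ ≤ V + (0 + ∑' n, ENNReal.ofReal (a n)) := by
        refine add_le_add hS₁ (add_le_add hS₀.le ?_)
        exact (lintegral_iUnion_le _ _).trans (ENNReal.tsum_le_tsum hT)
    _ = _ := by rw [zero_add]

/-! ### Perturbations of sparse polynomials -/

theorem circleIntegral_inv_pow_mul_pow (j k : ℕ) :
    ∮ ζ in C(1, 1 / 4), ((ζ - 1)⁻¹) ^ (j + 1) * ζ ^ k = 2 * Real.pi * Complex.I * (k.choose j) := by
  have hr : (0 : ℝ) ≤ 1 / 4 := by norm_num
  have hne : ∀ ζ ∈ Metric.sphere (1 : ℂ) (1 / 4), ζ - 1 ≠ 0 := fun ζ hζ =>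
    norm_pos_iff.1 (by rw [mem_sphere_iff_norm.1 hζ]; norm_num)
  have hcongr : ∀ ζ ∈ Metric.sphere (1 : ℂ) (1 / 4), ((ζ - 1)⁻¹) ^ (j + 1) * ζ ^ k =
      ∑ m ∈ Finset.range (k + 1), (k.choose m : ℂ) * (ζ - 1) ^ ((m : ℤ) - j - 1) := by
    intro ζ hζ
    have h1 : ζ ^ k = ∑ m ∈ Finset.range (k + 1), (ζ - 1) ^ m * (k.choose m : ℂ) := by
      have := add_pow (ζ - 1) 1 k
      simpa using this
    rw [h1, Finset.mul_sum]
    refine Finset.sum_congr rfl fun m _ => ?_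
    rw [sub_sub, zpow_sub₀ (hne ζ hζ), zpow_natCast, inv_pow,
      show ((j : ℤ) + 1) = ((j + 1 : ℕ) : ℤ) by push_cast; rfl, zpow_natCast]
    ring
  rw [circleIntegral.integral_congr hr hcongr, circleIntegral.integral_fun_sum]
  · have hterm : ∀ m ∈ Finset.range (k + 1),
        (∮ ζ in C(1, 1 / 4), (k.choose m : ℂ) * (ζ - 1) ^ ((m : ℤ) - j - 1)) =
          if m = j then 2 * Real.pi * Complex.I * (k.choose j) else 0 := by
      intro m _
      rw [circleIntegral.integral_const_mul]
      split_ifs with hm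
      · subst hm
        have h2 : ∮ ζ in C(1, 1 / 4), (ζ - 1 : ℂ) ^ ((m : ℤ) - m - 1) =
            2 * Real.pi * Complex.I := by
          rw [← circleIntegral.integral_sub_inv_of_mem_ball (c := 1) (w := 1) (R := 1 / 4)
            (Metric.mem_ball_self (by norm_num))]
          simp
        rw [h2]; ring
      · rw [circleIntegral.integral_sub_zpow_of_ne (by omega), mul_zero]
    rw [Finset.sum_congr rfl hterm, Finset.sum_ite_eq']
    split_ifs with hj
    · rfl
    · rw [Nat.choose_eq_zero_of_lt (by simpa using hj)]; simp
  · intro m _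
    refine ContinuousOn.circleIntegrable hr (continuousOn_const.mul ?_)
    exact ContinuousOn.zpow₀ (by fun_prop) _ fun ζ hζ => Or.inl (hne ζ hζ)

/-- Uniform integrability of `|H| ^ (-2 c)` near `1` when `H` is a small perturbation of a
normalized polynomial of degree `d` whose consecutive coefficients are never both large: then `1` is
at most a zero of order `d / 2`, in a quantitative sense. -/
theorem exists_lintegral_le_of_norm_eq_one (d : ℕ) {c : ℝ} (hc : 0 < c)
    (hcd : c * (d / 2 : ℕ) < 1) :
    ∃ ρ η : ℝ, 0 < ρ ∧ ρ ≤ 1 / 8 ∧ 0 < η ∧ ∃ M : ℝ≥0∞, M ≠ ⊤ ∧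
      ∀ (H : ℂ → ℂ) (h : Fin (d + 1) → ℂ), DifferentiableOn ℂ H (Metric.ball 1 (1 / 2)) →
      ‖h‖ = 1 → (∀ i : Fin d, min ‖h i.castSucc‖ ‖h i.succ‖ ≤ η) →
      (∀ u ∈ Metric.ball (1 : ℂ) (1 / 2), ‖H u - ∑ k, h k * u ^ (k : ℕ)‖ ≤ η) →
      ∫⁻ u in Metric.ball (1 : ℂ) ρ, ‖H u‖ₑ ^ (-(2 * c)) ≤ M := by
  have hpi := Real.pi_pos
  obtain ⟨c₀, hc₀, hlow⟩ := exists_le_sum_norm_sum_choose d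
  set c₂ : ℝ := c₀ / 2 / ((d / 2 : ℕ) + 1) with hc₂
  have hc₂0 : 0 < c₂ := by positivity
  set η : ℝ := min 1 (min (c₀ / (2 * (d + 1))) (c₂ / (2 * 4 ^ d))) with hη
  have hη0 : 0 < η := by positivity
  have hη1 : η ≤ 1 := min_le_left _ _
  have hη2 : η * (2 * (d + 1)) ≤ c₀ := by
    have : η ≤ c₀ / (2 * (d + 1)) := (min_le_right _ _).trans (min_le_left _ _)
    rwa [le_div_iff₀ (by positivity)] at this
  have hη3 : η * (2 * 4 ^ d) ≤ c₂ := by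
    have : η ≤ c₂ / (2 * 4 ^ d) := (min_le_right _ _).trans (min_le_right _ _)
    rwa [le_div_iff₀ (by positivity)] at this
  -- the second entry only serves to make `κ` positive
  set κ : ℝ := max (d / 2 : ℕ) (1 / (2 * c)) with hκ
  have hκ0 : 0 < κ := lt_max_of_lt_right (by positivity)
  have hcκ : 2 * c < 2 / κ := by
    rw [lt_div_iff₀ hκ0]
    have h1 : c * κ < 1 := by
      rw [hκ]
      rcases max_choice ((d / 2 : ℕ) : ℝ) (1 / (2 * c)) with h | h <;> rw [h]
      · exact hcd
      · rw [show c * (1 / (2 * c)) = 1 / 2 by field_simp]; norm_num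
    linarith
  obtain ⟨ρ, C, hρ0, hρ8, hC0, hvol⟩ := exists_volume_sublevel_le
    (K := (d + 1) * 2 ^ d + 1) (c₁ := Real.pi * c₂) (κ := κ) (by positivity) (by positivity) hκ0
  obtain ⟨M, hM, hint⟩ := exists_lintegral_le_of_sublevel_le (V := volume (Metric.ball (1 : ℂ) ρ))
    hC0 hc hcκ (by rw [Complex.volume_ball]; finiteness)
  refine ⟨ρ, η, hρ0, hρ8, hη0, M, hM, fun H h hH hh hadj happ => hint _ H le_rfl ?_⟩
  have hsph : Metric.sphere (1 : ℂ) (1 / 4) ⊆ Metric.ball 1 (1 / 2) :=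
    Metric.sphere_subset_closedBall.trans (Metric.closedBall_subset_ball (by norm_num))
  have hr : (0 : ℝ) ≤ 1 / 4 := by norm_num
  have hK : ∀ ζ ∈ Metric.sphere (1 : ℂ) (1 / 4), ‖H ζ‖ ≤ (d + 1) * 2 ^ d + 1 := by
    intro ζ hζ
    have hζ2 : ‖ζ‖ ≤ 2 := by
      have h1 := norm_sub_norm_le ζ 1
      rw [mem_sphere_iff_norm.1 hζ, norm_one] at h1
      linarith
    have h2 : ‖∑ k, h k * ζ ^ (k : ℕ)‖ ≤ (d + 1) * 2 ^ d := by
      refine (norm_sum_le_of_le (f := fun k => h k * ζ ^ (k : ℕ)) (n := fun _ => 2 ^ d) _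
        fun k _ => ?_).trans_eq (by simp)
      rw [norm_mul, norm_pow]
      calc ‖h k‖ * ‖ζ‖ ^ (k : ℕ) ≤ 1 * 2 ^ (k : ℕ) := by
            gcongr
            exact (norm_le_pi_norm h k).trans hh.le
        _ ≤ 2 ^ d := by
            rw [one_mul]
            exact pow_le_pow_right₀ (by norm_num) (by omega)
    have h3 := norm_le_norm_add_norm_sub' (H ζ) (∑ k, h k * ζ ^ (k : ℕ))
    linarith [happ ζ (hsph hζ)]
  obtain ⟨j, hj, hTj⟩ : ∃ j ∈ Finset.range (d / 2 + 1),
      c₂ ≤ ‖∑ k : Fin (d + 1), ((k : ℕ).choose j : ℂ) * h k‖ := by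
    refine Finset.exists_le_of_sum_le (by simp) ?_
    have h1 := hlow h
    have h2 : ∑ i : Fin d, min ‖h i.castSucc‖ ‖h i.succ‖ ≤ d * η := by
      refine (Finset.sum_le_sum fun i _ => hadj i).trans_eq (by simp)
    rw [hh] at h1
    have h3 : ∑ j ∈ Finset.range (d / 2 + 1), c₂ = c₀ / 2 := by
      rw [Finset.sum_const, Finset.card_range, nsmul_eq_mul, hc₂]
      push_cast
      field_simp
    rw [h3]
    nlinarith
  have hjd : j ≤ d / 2 := by have := Finset.mem_range.1 hj; omega
  refine hvol H hH hK j (le_max_of_le_left (by exact_mod_cast hjd)) ?_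
  have hne : ∀ ζ ∈ Metric.sphere (1 : ℂ) (1 / 4), ζ - 1 ≠ 0 := fun ζ hζ =>
    norm_pos_iff.1 (by rw [mem_sphere_iff_norm.1 hζ]; norm_num)
  have hcont : ContinuousOn (fun ζ : ℂ => ((ζ - 1)⁻¹) ^ (j + 1)) (Metric.sphere 1 (1 / 4)) :=
    (ContinuousOn.inv₀ (by fun_prop) hne).pow _
  have hpoly : ∮ ζ in C(1, 1 / 4), ((ζ - 1)⁻¹) ^ (j + 1) * ∑ k, h k * ζ ^ (k : ℕ) =
      2 * Real.pi * Complex.I * ∑ k : Fin (d + 1), ((k : ℕ).choose j : ℂ) * h k := by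
    simp only [Finset.mul_sum]
    rw [circleIntegral.integral_fun_sum]
    · refine Finset.sum_congr rfl fun k _ => ?_
      rw [show (fun ζ : ℂ => ((ζ - 1)⁻¹) ^ (j + 1) * (h k * ζ ^ (k : ℕ))) =
        fun ζ => h k * (((ζ - 1)⁻¹) ^ (j + 1) * ζ ^ (k : ℕ)) by funext ζ; ring,
        circleIntegral.integral_const_mul, circleIntegral_inv_pow_mul_pow]
      ring
    · intro k _
      exact (hcont.mul (by fun_prop)).circleIntegrable hr
  have hdiff : ‖(∮ ζ in C(1, 1 / 4), ((ζ - 1)⁻¹) ^ (j + 1) * H ζ) -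
      ∮ ζ in C(1, 1 / 4), ((ζ - 1)⁻¹) ^ (j + 1) * ∑ k, h k * ζ ^ (k : ℕ)‖ ≤ Real.pi * c₂ := by
    rw [← circleIntegral.integral_sub]
    · have hb : ∀ ζ ∈ Metric.sphere (1 : ℂ) (1 / 4), ‖((ζ - 1)⁻¹) ^ (j + 1) * H ζ -
          ((ζ - 1)⁻¹) ^ (j + 1) * ∑ k, h k * ζ ^ (k : ℕ)‖ ≤ 4 * 4 ^ d * η := by
        intro ζ hζ
        rw [← mul_sub, norm_mul, norm_pow, norm_inv, mem_sphere_iff_norm.1 hζ]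
        refine mul_le_mul ?_ (happ ζ (hsph hζ)) (norm_nonneg _) (by positivity)
        rw [one_div, inv_inv, ← pow_succ']
        exact pow_le_pow_right₀ (by norm_num) (by omega)
      refine (circleIntegral.norm_integral_le_of_norm_le_const hr hb).trans ?_
      nlinarith
    · exact (hcont.mul (hH.continuousOn.mono hsph)).circleIntegrable hr
    · exact (hcont.mul (by fun_prop)).circleIntegrable hr
  have h2 : ‖(2 * Real.pi * Complex.I : ℂ)‖ = 2 * Real.pi := by
    simp [abs_of_pos hpi]
  have h3 := norm_sub_norm_le
    (∮ ζ in C(1, 1 / 4), ((ζ - 1)⁻¹) ^ (j + 1) * ∑ k, h k * ζ ^ (k : ℕ))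
    (∮ ζ in C(1, 1 / 4), ((ζ - 1)⁻¹) ^ (j + 1) * H ζ)
  rw [norm_sub_rev, hpoly, norm_mul, h2] at h3
  rw [hpoly] at hdiff
  nlinarith

/-- Homogeneous form of `exists_lintegral_le_of_norm_eq_one`. -/
theorem exists_lintegral_le_of_near_sparse (d : ℕ) {c : ℝ} (hc : 0 < c)
    (hcd : c * (d / 2 : ℕ) < 1) :
    ∃ ρ η : ℝ, 0 < ρ ∧ ρ ≤ 1 / 8 ∧ 0 < η ∧ ∃ M : ℝ≥0∞, M ≠ ⊤ ∧
      ∀ (H : ℂ → ℂ) (h : Fin (d + 1) → ℂ), DifferentiableOn ℂ H (Metric.ball 1 (1 / 2)) →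
      0 < ‖h‖ → (∀ i : Fin d, min ‖h i.castSucc‖ ‖h i.succ‖ ≤ η * ‖h‖) →
      (∀ u ∈ Metric.ball (1 : ℂ) (1 / 2), ‖H u - ∑ k, h k * u ^ (k : ℕ)‖ ≤ η * ‖h‖) →
      ∫⁻ u in Metric.ball (1 : ℂ) ρ, ‖H u‖ₑ ^ (-(2 * c)) ≤
        ENNReal.ofReal (‖h‖ ^ (-(2 * c))) * M := by
  obtain ⟨ρ, η, hρ0, hρ8, hη, M, hM, hmain⟩ := exists_lintegral_le_of_norm_eq_one d hc hcd
  refine ⟨ρ, η, hρ0, hρ8, hη, M, hM, fun H h hH hh hadj happ => ?_⟩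
  set N := ‖h‖ with hN
  have hN' : ‖((N⁻¹ : ℝ) : ℂ)‖ = N⁻¹ := by simp [abs_of_pos hh]
  have hcancel : ∀ x : ℝ, x ≤ η * N → N⁻¹ * x ≤ η := fun x hx => by
    rw [inv_mul_le_iff₀ hh]; linarith
  have key := hmain (fun u => ((N⁻¹ : ℝ) : ℂ) * H u) (((N⁻¹ : ℝ) : ℂ) • h) (hH.const_mul _)
    (by rw [norm_smul, hN', ← hN, inv_mul_cancel₀ hh.ne'])
    (fun i => by
      simp only [Pi.smul_apply, smul_eq_mul, norm_mul, hN']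
      rw [← mul_min_of_nonneg _ _ (inv_nonneg.2 hh.le)]
      exact hcancel _ (hadj i))
    (fun u hu => by
      simp only [Pi.smul_apply, smul_eq_mul, mul_assoc]
      rw [← Finset.mul_sum, ← mul_sub, norm_mul, hN']
      exact hcancel _ (happ u hu))
  have hpt : ∀ u, ‖H u‖ₑ ^ (-(2 * c)) =
      ENNReal.ofReal (N ^ (-(2 * c))) * ‖((N⁻¹ : ℝ) : ℂ) * H u‖ₑ ^ (-(2 * c)) := by
    intro u
    have h1 : H u = (N : ℂ) * (((N⁻¹ : ℝ) : ℂ) * H u) := by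
      have : (N : ℂ) ≠ 0 := by exact_mod_cast hh.ne'
      push_cast
      field_simp
    have h2 : ‖(N : ℂ)‖ₑ = ENNReal.ofReal N := by
      rw [← ofReal_norm]; simp [abs_of_pos hh]
    conv_lhs => rw [h1]
    rw [enorm_mul, ENNReal.mul_rpow_of_ne_top enorm_ne_top enorm_ne_top, h2,
      ENNReal.ofReal_rpow_of_pos hh]
  simp_rw [hpt]
  rw [lintegral_const_mul' _ _ ENNReal.ofReal_ne_top]
  gcongr

/-! ### Restricting a double power series to a fibre -/

/-- The sum of the double power series with coefficients `a` at `(x, y)`. -/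
noncomputable def doubleSum (a : ℕ × ℕ → ℂ) (x y : ℂ) : ℂ :=
  ∑' k, a k * x ^ k.1 * y ^ k.2

/-- The power series in `t = x y` formed by the coefficients `a (n + m, n)` on the `m`-th diagonal:
the coefficient of `x ^ m` in the restriction of `doubleSum a` to `x y = t`. -/
noncomputable def diagSum (a : ℕ × ℕ → ℂ) (m : ℕ) (t : ℂ) : ℂ :=
  ∑' n, a (n + m, n) * t ^ n

theorem analyticAt_tsum_mul_pow {b : ℕ → ℂ} {r : ℝ} (hr : 0 < r)
    (hb : Summable fun n => ‖b n‖ * r ^ n) : AnalyticAt ℂ (fun t => ∑' n, b n * t ^ n) 0 := by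
  refine DifferentiableOn.analyticAt (s := Metric.ball 0 r) ?_ (Metric.ball_mem_nhds _ hr)
  refine Complex.differentiableOn_tsum_of_summable_norm hb (fun n => by fun_prop)
    Metric.isOpen_ball fun n w hw => ?_
  rw [norm_mul, norm_pow]
  gcongr
  exact (mem_ball_zero_iff.1 hw).le

variable {a : ℕ × ℕ → ℂ} {ρ : ℝ}

theorem analyticAt_diagSum (hρ : 0 < ρ) (hS : Summable fun k => ‖a k‖ * ρ ^ k.1 * ρ ^ k.2)
    (m : ℕ) : AnalyticAt ℂ (diagSum a m) 0 := by
  refine analyticAt_tsum_mul_pow (r := ρ ^ 2) (by positivity) ?_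
  have hinj : Function.Injective fun n : ℕ => ((n + m, n) : ℕ × ℕ) := fun i j h => by
    simpa using congrArg Prod.snd h
  have := (hS.comp_injective hinj).mul_left (ρ ^ m)⁻¹
  refine this.congr fun n => ?_
  simp only [Function.comp_apply]
  have : ρ ^ m ≠ 0 := by positivity
  rw [pow_add, ← pow_mul, mul_comm 2 n, pow_mul]
  field_simp

theorem diagSum_zero (a : ℕ × ℕ → ℂ) (m : ℕ) : diagSum a m 0 = a (m, 0) := by
  rw [diagSum, tsum_eq_single 0 fun n hn => by simp [hn]]
  simp

theorem summable_swap (hS : Summable fun k => ‖a k‖ * ρ ^ k.1 * ρ ^ k.2) :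
    Summable fun k => ‖(a ∘ Prod.swap) k‖ * ρ ^ k.1 * ρ ^ k.2 := by
  have := (Equiv.prodComm ℕ ℕ).summable_iff.2 hS
  refine this.congr fun k => ?_
  simp only [Function.comp_apply, Equiv.prodComm_apply, Prod.fst_swap, Prod.snd_swap]
  ring

theorem eventually_norm_le_mul_norm {f g : ℂ → ℂ} (hf : AnalyticAt ℂ f 0) (hg : AnalyticAt ℂ g 0)
    (hg0 : g 0 ≠ 0) : ∃ C : ℝ, 0 < C ∧ ∀ᶠ t in 𝓝 (0 : ℂ), ‖f t‖ ≤ C * ‖g t‖ := by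
  have hlim : ContinuousAt (fun t => ‖f t / g t‖) 0 :=
    (hf.continuousAt.div hg.continuousAt hg0).norm
  refine ⟨‖f 0 / g 0‖ + 1, by positivity, ?_⟩
  filter_upwards [hlim.eventually_lt_const (lt_add_one _), hg.continuousAt.eventually_ne hg0]
    with t ht hgt
  rw [norm_div, div_lt_iff₀ (norm_pos_iff.2 hgt)] at ht
  exact ht.le

/-- Orders of vanishing are integers: if `g` is not `O(f)`, then `f` is `O(t g)`. -/
theorem eventually_norm_le_or_norm_le {f g : ℂ → ℂ} (hf : AnalyticAt ℂ f 0)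
    (hg : AnalyticAt ℂ g 0) : ∃ C : ℝ, 0 < C ∧ ((∀ᶠ t in 𝓝 (0 : ℂ), ‖g t‖ ≤ C * ‖f t‖) ∨
      ∀ᶠ t in 𝓝 (0 : ℂ), ‖f t‖ ≤ C * ‖t‖ * ‖g t‖) := by
  by_cases hg0 : ∀ᶠ t in 𝓝 (0 : ℂ), g t = 0
  · refine ⟨1, one_pos, Or.inl ?_⟩
    filter_upwards [hg0] with t ht
    rw [ht, norm_zero]; positivity
  by_cases hf0 : ∀ᶠ t in 𝓝 (0 : ℂ), f t = 0
  · refine ⟨1, one_pos, Or.inr ?_⟩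
    filter_upwards [hf0] with t ht
    rw [ht, norm_zero]; positivity
  obtain ⟨n, F, hF, hFne, hfF⟩ := hf.exists_eventuallyEq_pow_smul_nonzero_iff.2 hf0
  obtain ⟨m, G, hG, hGne, hgG⟩ := hg.exists_eventuallyEq_pow_smul_nonzero_iff.2 hg0
  have hsmall : ∀ᶠ t in 𝓝 (0 : ℂ), ‖t‖ ≤ 1 := by
    filter_upwards [Metric.closedBall_mem_nhds (0 : ℂ) one_pos] with t ht
    exact mem_closedBall_zero_iff.1 ht
  rcases le_or_gt n m with hnm | hnm
  · obtain ⟨C, hC, hev⟩ := eventually_norm_le_mul_norm hG hF hFne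
    refine ⟨C, hC, Or.inl ?_⟩
    filter_upwards [hev, hfF, hgG, hsmall] with t h1 h2 h3 h4
    rw [h2, h3, sub_zero, norm_smul, norm_smul, norm_pow, norm_pow, mul_left_comm]
    exact mul_le_mul (pow_le_pow_of_le_one (norm_nonneg _) h4 hnm) h1 (norm_nonneg _)
      (by positivity)
  · obtain ⟨C, hC, hev⟩ := eventually_norm_le_mul_norm hF hG hGne
    refine ⟨C, hC, Or.inr ?_⟩
    filter_upwards [hev, hfF, hgG, hsmall] with t h1 h2 h3 h4
    rw [h2, h3, sub_zero, norm_smul, norm_smul, norm_pow, norm_pow]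
    calc ‖t‖ ^ n * ‖F t‖ ≤ ‖t‖ ^ (m + 1) * (C * ‖G t‖) :=
          mul_le_mul (pow_le_pow_of_le_one (norm_nonneg _) h4 hnm) h1 (norm_nonneg _)
            (by positivity)
      _ = _ := by ring

/-- The dominant coefficients, of `u ^ i` for `0 ≤ i ≤ p + q`, in the Laurent expansion of
`u ^ q F(x u, y / u)`, where `z = (x, y)`. -/
noncomputable def coeffVec (a : ℕ × ℕ → ℂ) (p q : ℕ) (z : ℂ × ℂ) (i : Fin (p + q + 1)) : ℂ :=
  if q ≤ i then z.1 ^ ((i : ℕ) - q) * diagSum a (i - q) (z.1 * z.2)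
  else z.2 ^ (q - (i : ℕ)) * diagSum (a ∘ Prod.swap) (q - i) (z.1 * z.2)

theorem coeffVec_of_le {p q : ℕ} (z : ℂ × ℂ) {i : Fin (p + q + 1)} (h : q ≤ i) :
    coeffVec a p q z i = z.1 ^ ((i : ℕ) - q) * diagSum a (i - q) (z.1 * z.2) := if_pos h

theorem coeffVec_of_ge {p q : ℕ} (z : ℂ × ℂ) {i : Fin (p + q + 1)} (h : (i : ℕ) ≤ q) :
    coeffVec a p q z i =
      z.2 ^ (q - (i : ℕ)) * diagSum (a ∘ Prod.swap) (q - i) (z.1 * z.2) := by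
  rcases h.lt_or_eq with h | h
  · exact if_neg (by omega)
  · rw [coeffVec_of_le z h.ge]
    simp [h, diagSum]

theorem tendsto_mul_zero : Tendsto (fun z : ℂ × ℂ => z.1 * z.2) (𝓝 0) (𝓝 0) := by
  have : Continuous fun z : ℂ × ℂ => z.1 * z.2 := by fun_prop
  simpa using this.tendsto 0

theorem tendsto_mul_norm_zero (C : ℝ) : Tendsto (fun z : ℂ × ℂ => C * ‖z‖) (𝓝 0) (𝓝 0) := by
  have : Continuous fun z : ℂ × ℂ => C * ‖z‖ := by fun_prop
  simpa using this.tendsto 0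

/-- Consecutive coefficients of the Laurent expansion are never comparable near the origin: their
quotient behaves like `x t ^ l` with `l` an integer, and `x y = t`. -/
theorem eventually_min_coeffVec_le (hρ : 0 < ρ)
    (hS : Summable fun k => ‖a k‖ * ρ ^ k.1 * ρ ^ k.2) (p q : ℕ) {η : ℝ} (hη : 0 < η) :
    ∀ᶠ z : ℂ × ℂ in 𝓝 0, ∀ i : Fin (p + q),
      min ‖coeffVec a p q z i.castSucc‖ ‖coeffVec a p q z i.succ‖ ≤ η * ‖coeffVec a p q z‖ := by
  rw [eventually_all]
  intro i
  -- the same alternative settles both halves of the index range, up to exchanging `x` and `y`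
  have key : ∀ b : ℕ × ℕ → ℂ, Summable (fun k => ‖b k‖ * ρ ^ k.1 * ρ ^ k.2) → ∀ m : ℕ,
      ∀ᶠ z : ℂ × ℂ in 𝓝 0, ∀ w v : ℂ, z.1 * z.2 = w * v → ‖w‖ ≤ ‖z‖ → ‖v‖ ≤ ‖z‖ → ∀ N : ℝ,
        ‖w ^ m * diagSum b m (z.1 * z.2)‖ ≤ N → ‖w ^ (m + 1) * diagSum b (m + 1) (z.1 * z.2)‖ ≤ N →
        min ‖w ^ m * diagSum b m (z.1 * z.2)‖ ‖w ^ (m + 1) * diagSum b (m + 1) (z.1 * z.2)‖ ≤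
          η * N := by
    intro b hb m
    obtain ⟨C, hC, hev⟩ := eventually_norm_le_or_norm_le (analyticAt_diagSum hρ hb m)
      (analyticAt_diagSum hρ hb (m + 1))
    have hsmall := (tendsto_mul_norm_zero C).eventually_le_const hη
    rcases hev with hev | hev
    · filter_upwards [tendsto_mul_zero.eventually hev, hsmall] with z h1 h2 w v hwv hw hv N hN1 hN2
      refine (min_le_right _ _).trans ?_
      have hN0 : 0 ≤ N := (norm_nonneg _).trans hN1
      calc ‖w ^ (m + 1) * diagSum b (m + 1) (z.1 * z.2)‖
          = ‖w‖ ^ m * ‖w‖ * ‖diagSum b (m + 1) (z.1 * z.2)‖ := by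
            rw [norm_mul, norm_pow, pow_succ]
        _ ≤ ‖w‖ ^ m * ‖z‖ * (C * ‖diagSum b m (z.1 * z.2)‖) := by gcongr
        _ = (C * ‖z‖) * ‖w ^ m * diagSum b m (z.1 * z.2)‖ := by
            rw [norm_mul, norm_pow]; ring
        _ ≤ η * N := by gcongr
    · filter_upwards [tendsto_mul_zero.eventually hev, hsmall] with z h1 h2 w v hwv hw hv N hN1 hN2
      refine (min_le_left _ _).trans ?_
      have hN0 : 0 ≤ N := (norm_nonneg _).trans hN1
      have hzw : ‖z.1 * z.2‖ ≤ ‖w‖ * ‖z‖ := by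
        rw [hwv, norm_mul]; gcongr
      calc ‖w ^ m * diagSum b m (z.1 * z.2)‖
          = ‖w‖ ^ m * ‖diagSum b m (z.1 * z.2)‖ := by rw [norm_mul, norm_pow]
        _ ≤ ‖w‖ ^ m * (C * (‖w‖ * ‖z‖) * ‖diagSum b (m + 1) (z.1 * z.2)‖) := by
            refine mul_le_mul_of_nonneg_left (h1.trans ?_) (by positivity)
            gcongr
        _ = (C * ‖z‖) * ‖w ^ (m + 1) * diagSum b (m + 1) (z.1 * z.2)‖ := by
            rw [norm_mul, norm_pow]; ring
        _ ≤ η * N := by gcongr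
  rcases le_or_gt q (i : ℕ) with hi | hi
  · filter_upwards [key a hS (i - q)] with z hz
    have h1 := norm_le_pi_norm (coeffVec a p q z) i.castSucc
    have h2 := norm_le_pi_norm (coeffVec a p q z) i.succ
    rw [coeffVec_of_le z (by simpa using hi)] at h1 ⊢
    rw [coeffVec_of_le z (by simp; omega)] at h2 ⊢
    simp only [Fin.val_castSucc, Fin.val_succ, Nat.sub_add_comm hi] at h1 h2 ⊢
    exact hz z.1 z.2 rfl (norm_fst_le z) (norm_snd_le z) _ h1 h2
  · filter_upwards [key (a ∘ Prod.swap) (summable_swap hS) (q - i - 1)] with z hz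
    have h1 := norm_le_pi_norm (coeffVec a p q z) i.castSucc
    have h2 := norm_le_pi_norm (coeffVec a p q z) i.succ
    rw [coeffVec_of_ge z (by simp; omega)] at h1 ⊢
    rw [coeffVec_of_ge z (by simp; omega)] at h2 ⊢
    simp only [Fin.val_castSucc, Fin.val_succ] at h1 h2 ⊢
    rw [show q - ((i : ℕ) + 1) = q - i - 1 by omega] at h2 ⊢
    rw [show q - (i : ℕ) = q - i - 1 + 1 by omega] at h1 ⊢
    rw [min_comm]
    exact hz z.2 z.1 (mul_comm _ _) (norm_snd_le z) (norm_fst_le z) _ h2 h1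

theorem eventually_le_norm_coeffVec (hρ : 0 < ρ)
    (hS : Summable fun k => ‖a k‖ * ρ ^ k.1 * ρ ^ k.2) {p q : ℕ} (hp : a (p, 0) ≠ 0)
    (hq : a (0, q) ≠ 0) : ∃ b : ℝ, 0 < b ∧ ∀ᶠ z : ℂ × ℂ in 𝓝 0,
      b * ‖z.1‖ ^ p ≤ ‖coeffVec a p q z‖ ∧ b * ‖z.2‖ ^ q ≤ ‖coeffVec a p q z‖ := by
  have key : ∀ b : ℕ × ℕ → ℂ, Summable (fun k => ‖b k‖ * ρ ^ k.1 * ρ ^ k.2) → ∀ m : ℕ,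
      b (m, 0) ≠ 0 → ∀ᶠ z : ℂ × ℂ in 𝓝 0, ‖b (m, 0)‖ / 2 ≤ ‖diagSum b m (z.1 * z.2)‖ := by
    intro b hb m hm
    have h1 := (analyticAt_diagSum hρ hb m).continuousAt.norm
    have h2 : ‖b (m, 0)‖ / 2 < ‖diagSum b m 0‖ := by
      rw [diagSum_zero]; exact half_lt_self (norm_pos_iff.2 hm)
    filter_upwards [tendsto_mul_zero.eventually (h1.eventually_const_lt h2)] with z hz
    exact hz.le
  refine ⟨min (‖a (p, 0)‖ / 2) (‖a (0, q)‖ / 2),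
    lt_min (half_pos (norm_pos_iff.2 hp)) (half_pos (norm_pos_iff.2 hq)), ?_⟩
  filter_upwards [key a hS p hp, key (a ∘ Prod.swap) (summable_swap hS) q (by simpa using hq)]
    with z hz1 hz2
  constructor
  · refine le_trans ?_ (norm_le_pi_norm (coeffVec a p q z) (Fin.last (p + q)))
    rw [coeffVec_of_le z (by simp), norm_mul, norm_pow, mul_comm]
    simp only [Fin.val_last, Nat.add_sub_cancel]
    exact mul_le_mul_of_nonneg_left ((min_le_left _ _).trans hz1) (by positivity)
  · refine le_trans ?_ (norm_le_pi_norm (coeffVec a p q z) 0)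
    rw [coeffVec_of_ge z (by simp), norm_mul, norm_pow, mul_comm]
    simp only [Fin.val_zero, Nat.sub_zero]
    exact mul_le_mul_of_nonneg_left ((min_le_right _ _).trans hz2) (by positivity)

/-! ### The integral near a point of a fibre -/

theorem norm_coeff_mul_pow_le (a : ℕ × ℕ → ℂ) {x y : ℂ} (hx : ‖x‖ ≤ ρ) (hy : ‖y‖ ≤ ρ)
    (k : ℕ × ℕ) : ‖a k * x ^ k.1 * y ^ k.2‖ ≤ ‖a k‖ * ρ ^ k.1 * ρ ^ k.2 := by
  rw [norm_mul, norm_mul, norm_pow, norm_pow]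
  have := (norm_nonneg x).trans hx
  gcongr

theorem summable_coeff_mul_pow (hS : Summable fun k => ‖a k‖ * ρ ^ k.1 * ρ ^ k.2) {x y : ℂ}
    (hx : ‖x‖ ≤ ρ) (hy : ‖y‖ ≤ ρ) : Summable fun k => a k * x ^ k.1 * y ^ k.2 :=
  Summable.of_norm_bounded hS (norm_coeff_mul_pow_le a hx hy)

theorem bounds_of_mem_ball {u : ℂ} (hu : u ∈ Metric.ball (1 : ℂ) (1 / 2)) :
    1 / 2 ≤ ‖u‖ ∧ ‖u‖ ≤ 2 := by
  have h := mem_ball_iff_norm.1 hu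
  have h1 := norm_sub_norm_le u 1
  have h2 := norm_sub_norm_le 1 u
  rw [norm_sub_rev] at h2
  rw [norm_one] at h1 h2
  constructor <;> linarith

theorem norm_mul_le_of_mem_ball {u x : ℂ} (hu : u ∈ Metric.ball (1 : ℂ) (1 / 2)) :
    ‖x * u‖ ≤ 2 * ‖x‖ := by
  rw [norm_mul, mul_comm]
  exact mul_le_mul_of_nonneg_right (bounds_of_mem_ball hu).2 (norm_nonneg _)

theorem norm_div_le_of_mem_ball {u x : ℂ} (hu : u ∈ Metric.ball (1 : ℂ) (1 / 2)) :
    ‖x / u‖ ≤ 2 * ‖x‖ := by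
  have := (bounds_of_mem_ball hu).1
  rw [norm_div, div_le_iff₀ (by linarith)]
  nlinarith [norm_nonneg x]

theorem ne_zero_of_mem_ball {u : ℂ} (hu : u ∈ Metric.ball (1 : ℂ) (1 / 2)) : u ≠ 0 :=
  norm_pos_iff.1 (by linarith [(bounds_of_mem_ball hu).1])

theorem differentiableOn_pow_mul_doubleSum
    (hS : Summable fun k => ‖a k‖ * ρ ^ k.1 * ρ ^ k.2) (q : ℕ) {x y : ℂ} (hx : 2 * ‖x‖ ≤ ρ)
    (hy : 2 * ‖y‖ ≤ ρ) : DifferentiableOn ℂ (fun u => u ^ q * doubleSum a (x * u) (y / u))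
      (Metric.ball 1 (1 / 2)) := by
  refine DifferentiableOn.mul (by fun_prop) ?_
  refine Complex.differentiableOn_tsum_of_summable_norm hS (fun k => ?_) Metric.isOpen_ball
    fun k u hu => norm_coeff_mul_pow_le a ((norm_mul_le_of_mem_ball hu).trans hx)
      ((norm_div_le_of_mem_ball hu).trans hy) k
  refine DifferentiableOn.mul (by fun_prop) (DifferentiableOn.pow ?_ _)
  exact DifferentiableOn.div (by fun_prop) (by fun_prop) fun u hu => ne_zero_of_mem_ball hu

/-- The terms of the double series that contribute to `u ^ i` in the Laurent expansion of
`u ^ q F(x u, y / u)` add up to `coeffVec a p q (x, y) i * u ^ i`. -/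
theorem coeffVec_mul_pow (a : ℕ × ℕ → ℂ) (p q : ℕ) (z : ℂ × ℂ) {u : ℂ} (hu : u ≠ 0)
    (i : Fin (p + q + 1)) : coeffVec a p q z i * u ^ (i : ℕ) =
      ∑' k : ℕ × ℕ, if k.1 + q = k.2 + i then
        u ^ q * (a k * (z.1 * u) ^ k.1 * (z.2 / u) ^ k.2) else 0 := by
  have ht : (z.1 * u) * (z.2 / u) = z.1 * z.2 := by field_simp
  rcases le_total q (i : ℕ) with hi | hi
  · obtain ⟨m, hm⟩ := Nat.exists_eq_add_of_le hi
    have hinj : Function.Injective fun n : ℕ => ((n + m, n) : ℕ × ℕ) := fun i j h => by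
      simpa using congrArg Prod.snd h
    rw [← hinj.tsum_eq, coeffVec_of_le z hi, diagSum, mul_right_comm, ← tsum_mul_left]
    · refine tsum_congr fun n => ?_
      rw [if_pos (by simp only; omega)]
      simp only [hm, Nat.add_sub_cancel_left]
      rw [pow_add (z.1 * u), ← ht, mul_pow, mul_pow z.1 u m, pow_add]
      ring
    · intro k hk
      rw [Function.mem_support] at hk
      have hk' : k.1 + q = k.2 + i := by
        by_contra h; exact hk (if_neg h)
      exact ⟨k.2, Prod.ext (by simp only; omega) rfl⟩
  · obtain ⟨m, hm⟩ := Nat.exists_eq_add_of_le hi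
    have hinj : Function.Injective fun n : ℕ => ((n, n + m) : ℕ × ℕ) := fun i j h => by
      simpa using congrArg Prod.fst h
    rw [← hinj.tsum_eq, coeffVec_of_ge z hi, diagSum, mul_right_comm, ← tsum_mul_left]
    · refine tsum_congr fun n => ?_
      rw [if_pos (by simp only; omega)]
      have hqi : q - (i : ℕ) = m := by omega
      have hum : u ^ q * (z.2 / u) ^ m = z.2 ^ m * u ^ (i : ℕ) := by
        have hq' : u ^ q = u ^ (i : ℕ) * u ^ m := by rw [← pow_add, ← hm]
        rw [hq', div_pow]; field_simp
      simp only [hqi, Function.comp_apply, Prod.swap_prod_mk]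
      rw [← hum, pow_add (z.2 / u), ← ht, mul_pow (z.1 * u)]
      ring
    · intro k hk
      rw [Function.mem_support] at hk
      have hk' : k.1 + q = k.2 + i := by
        by_contra h; exact hk (if_neg h)
      exact ⟨k.1, Prod.ext rfl (by simp only; omega)⟩

theorem norm_doubleSum_sub_le (hρ : 0 < ρ)
    (hS : Summable fun k => ‖a k‖ * ρ ^ k.1 * ρ ^ k.2) (p q : ℕ) {z : ℂ × ℂ}
    (hx : 2 * ‖z.1‖ ≤ ρ) (hy : 2 * ‖z.2‖ ≤ ρ) {u : ℂ} (hu : u ∈ Metric.ball (1 : ℂ) (1 / 2)) :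
    ‖u ^ q * doubleSum a (z.1 * u) (z.2 / u) - ∑ i, coeffVec a p q z i * u ^ (i : ℕ)‖ ≤
      2 ^ q * (∑' k, ‖a k‖ * ρ ^ k.1 * ρ ^ k.2) *
        ((2 * ‖z.1‖ / ρ) ^ (p + 1) + (2 * ‖z.2‖ / ρ) ^ (q + 1)) := by
  have hX := (norm_mul_le_of_mem_ball (x := z.1) hu)
  have hY := (norm_div_le_of_mem_ball (x := z.2) hu)
  have hu2 := (bounds_of_mem_ball hu).2
  set T : ℕ × ℕ → ℂ := fun k => u ^ q * (a k * (z.1 * u) ^ k.1 * (z.2 / u) ^ k.2) with hT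
  have hTs : Summable T := (summable_coeff_mul_pow hS (hX.trans hx) (hY.trans hy)).mul_left _
  set P : ℕ × ℕ → Prop := fun k => k.1 ≤ k.2 + p ∧ k.2 ≤ k.1 + q with hP
  have hsum : ∑ i, coeffVec a p q z i * u ^ (i : ℕ) = ∑' k, {k | P k}.indicator T k := by
    simp_rw [coeffVec_mul_pow a p q z (ne_zero_of_mem_ball hu)]
    rw [← Summable.tsum_finsetSum]
    · refine tsum_congr fun k => ?_
      by_cases hk : P k
      · rw [Set.indicator_of_mem (by exact hk)]
        have hlt : k.1 + q - k.2 < p + q + 1 := by have := hk.1; omega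
        rw [Finset.sum_eq_single ⟨k.1 + q - k.2, hlt⟩]
        · rw [if_pos (by have := hk.2; simp only; omega)]
        · intro i _ hi
          refine if_neg fun h => hi (Fin.ext ?_)
          simp only; omega
        · simp
      · rw [Set.indicator_of_notMem (by exact hk)]
        refine Finset.sum_eq_zero fun i _ => if_neg fun h => hk ?_
        have := i.2
        constructor <;> omega
    · intro i _
      exact hTs.indicator {k | k.1 + q = k.2 + i} |>.congr fun k => by
        simp [Set.indicator_apply, hT]
  have hG : u ^ q * doubleSum a (z.1 * u) (z.2 / u) = ∑' k, T k := tsum_mul_left.symm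
  rw [hG, hsum, ← hTs.tsum_sub (hTs.indicator _), mul_right_comm, ← tsum_mul_left]
  have hbound : ∀ k, ‖T k - {k | P k}.indicator T k‖ ≤
      2 ^ q * ((2 * ‖z.1‖ / ρ) ^ (p + 1) + (2 * ‖z.2‖ / ρ) ^ (q + 1)) *
        (‖a k‖ * ρ ^ k.1 * ρ ^ k.2) := by
    intro k
    have hx0 : 0 ≤ 2 * ‖z.1‖ / ρ := by positivity
    have hy0 : 0 ≤ 2 * ‖z.2‖ / ρ := by positivity
    have hx1 : 2 * ‖z.1‖ / ρ ≤ 1 := (div_le_one hρ).2 hx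
    have hy1 : 2 * ‖z.2‖ / ρ ≤ 1 := (div_le_one hρ).2 hy
    by_cases hk : P k
    · rw [Set.indicator_of_mem (by exact hk), sub_self, norm_zero]; positivity
    rw [Set.indicator_of_notMem (by exact hk), sub_zero]
    have h1 : (2 * ‖z.1‖ / ρ) ^ k.1 * (2 * ‖z.2‖ / ρ) ^ k.2 ≤
        (2 * ‖z.1‖ / ρ) ^ (p + 1) + (2 * ‖z.2‖ / ρ) ^ (q + 1) := by
      rcases Nat.lt_or_ge (k.2 + p) k.1 with h | h
      · calc (2 * ‖z.1‖ / ρ) ^ k.1 * (2 * ‖z.2‖ / ρ) ^ k.2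
            ≤ (2 * ‖z.1‖ / ρ) ^ (p + 1) * 1 := mul_le_mul
              (pow_le_pow_of_le_one hx0 hx1 (by omega)) (pow_le_one₀ hy0 hy1) (by positivity)
              (by positivity)
          _ ≤ _ := by rw [mul_one]; exact le_add_of_nonneg_right (by positivity)
      · have h' : k.1 + q < k.2 := by
          by_contra h''; exact hk ⟨h, by omega⟩
        calc (2 * ‖z.1‖ / ρ) ^ k.1 * (2 * ‖z.2‖ / ρ) ^ k.2
            ≤ 1 * (2 * ‖z.2‖ / ρ) ^ (q + 1) := mul_le_mul (pow_le_one₀ hx0 hx1)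
              (pow_le_pow_of_le_one hy0 hy1 (by omega)) (by positivity) zero_le_one
          _ ≤ _ := by rw [one_mul]; exact le_add_of_nonneg_left (by positivity)
    calc ‖T k‖ = ‖u‖ ^ q * (‖a k‖ * ‖z.1 * u‖ ^ k.1 * ‖z.2 / u‖ ^ k.2) := by
          simp only [hT, norm_mul, norm_pow]
      _ ≤ 2 ^ q * (‖a k‖ * (2 * ‖z.1‖) ^ k.1 * (2 * ‖z.2‖) ^ k.2) := by gcongr
      _ = 2 ^ q * ((2 * ‖z.1‖ / ρ) ^ k.1 * (2 * ‖z.2‖ / ρ) ^ k.2) *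
            (‖a k‖ * ρ ^ k.1 * ρ ^ k.2) := by
          rw [div_pow, div_pow]; field_simp
      _ ≤ _ := by gcongr
  exact tsum_of_norm_bounded (hS.mul_left _).hasSum hbound

/-- The ball estimate: near a point `(x, y)` of a fibre, in the coordinate `u ↦ (x u, y / u)`, the
integral of `|F| ^ (-2 c)` is controlled by its size on the coordinate axes. -/
theorem exists_lintegral_ball_le (hρ : 0 < ρ)
    (hS : Summable fun k => ‖a k‖ * ρ ^ k.1 * ρ ^ k.2) {p q : ℕ} (hp : a (p, 0) ≠ 0)
    (hq : a (0, q) ≠ 0) {c : ℝ} (hc : 0 < c) (hcp : c * p < 1) (hcq : c * q < 1) :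
    ∃ r R : ℝ, 0 < r ∧ r ≤ 1 / 8 ∧ 0 < R ∧ ∃ M : ℝ≥0∞, M ≠ ⊤ ∧ ∀ x y : ℂ, x ≠ 0 → y ≠ 0 →
      ‖x‖ ≤ R → ‖y‖ ≤ R →
      ∫⁻ u in Metric.ball (1 : ℂ) r, ‖doubleSum a (x * u) (y / u)‖ₑ ^ (-(2 * c)) ≤
        ENNReal.ofReal (‖x‖ ^ (-(2 * c * p))) * M ∧
      ∫⁻ u in Metric.ball (1 : ℂ) r, ‖doubleSum a (x * u) (y / u)‖ₑ ^ (-(2 * c)) ≤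
        ENNReal.ofReal (‖y‖ ^ (-(2 * c * q))) * M := by
  have hcd : c * ((p + q) / 2 : ℕ) < 1 := by
    have h1 : (((p + q) / 2 : ℕ) : ℝ) ≤ (p + q : ℕ) / 2 := Nat.cast_div_le
    push_cast at h1
    nlinarith
  obtain ⟨r, η, hr0, hr8, hη, M, hM, hmain⟩ := exists_lintegral_le_of_near_sparse (p + q) hc hcd
  obtain ⟨b, hb, hlow⟩ := eventually_le_norm_coeffVec hρ hS hp hq
  set A := ∑' k, ‖a k‖ * ρ ^ k.1 * ρ ^ k.2 with hA
  have hA0 : 0 ≤ A := tsum_nonneg fun k => by positivity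
  set D : ℝ := 2 ^ q * A * ((2 / ρ) ^ (p + 1) + (2 / ρ) ^ (q + 1)) / b with hD
  have hev : ∀ᶠ z : ℂ × ℂ in 𝓝 0, (b * ‖z.1‖ ^ p ≤ ‖coeffVec a p q z‖ ∧
      b * ‖z.2‖ ^ q ≤ ‖coeffVec a p q z‖) ∧ (∀ i : Fin (p + q),
      min ‖coeffVec a p q z i.castSucc‖ ‖coeffVec a p q z i.succ‖ ≤ η * ‖coeffVec a p q z‖) ∧
      2 * ‖z‖ ≤ ρ ∧ D * ‖z‖ ≤ η :=
    hlow.and ((eventually_min_coeffVec_le hρ hS p q hη).and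
      (((tendsto_mul_norm_zero 2).eventually_le_const hρ).and
        ((tendsto_mul_norm_zero D).eventually_le_const hη)))
  obtain ⟨R, hR, hball⟩ := Metric.nhds_basis_closedBall.eventually_iff.1 hev
  refine ⟨r, R, hr0, hr8, hR, ENNReal.ofReal (((2 : ℝ) ^ q) ^ (2 * c)) *
    (ENNReal.ofReal (b ^ (-(2 * c))) * M), by finiteness, fun x y hx hy hxR hyR => ?_⟩
  obtain ⟨⟨hbx, hby⟩, hadj, hzρ, hzD⟩ := hball (x := (x, y))
    (by rw [mem_closedBall_zero_iff, Prod.norm_def]; exact max_le hxR hyR)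
  have hxz : ‖x‖ ≤ ‖(x, y)‖ := norm_fst_le (x, y)
  have hyz : ‖y‖ ≤ ‖(x, y)‖ := norm_snd_le (x, y)
  simp only at hbx hby
  have hx0 := norm_pos_iff.2 hx
  have hy0 := norm_pos_iff.2 hy
  set N := ‖coeffVec a p q (x, y)‖ with hN
  have hN0 : 0 < N := lt_of_lt_of_le (by positivity) hbx
  have hint := hmain (fun u => u ^ q * doubleSum a (x * u) (y / u)) (coeffVec a p q (x, y))
    (differentiableOn_pow_mul_doubleSum hS q (by linarith) (by linarith)) hN0 hadj
    (fun u hu => by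
      refine (norm_doubleSum_sub_le hρ hS p q (z := (x, y)) (by simp only; linarith)
        (by simp only; linarith) hu).trans ?_
      simp only
      have e1 : (2 * ‖x‖ / ρ) ^ (p + 1) ≤ (2 / ρ) ^ (p + 1) * (‖(x, y)‖ * (N / b)) := by
        rw [show 2 * ‖x‖ / ρ = 2 / ρ * ‖x‖ by ring, mul_pow, pow_succ ‖x‖, mul_comm (‖x‖ ^ p)]
        have : ‖x‖ ^ p ≤ N / b := by rw [le_div_iff₀ hb]; linarith
        gcongr
      have e2 : (2 * ‖y‖ / ρ) ^ (q + 1) ≤ (2 / ρ) ^ (q + 1) * (‖(x, y)‖ * (N / b)) := by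
        rw [show 2 * ‖y‖ / ρ = 2 / ρ * ‖y‖ by ring, mul_pow, pow_succ ‖y‖, mul_comm (‖y‖ ^ q)]
        have : ‖y‖ ^ q ≤ N / b := by rw [le_div_iff₀ hb]; linarith
        gcongr
      calc 2 ^ q * A * ((2 * ‖x‖ / ρ) ^ (p + 1) + (2 * ‖y‖ / ρ) ^ (q + 1))
          ≤ 2 ^ q * A * ((2 / ρ) ^ (p + 1) * (‖(x, y)‖ * (N / b)) +
              (2 / ρ) ^ (q + 1) * (‖(x, y)‖ * (N / b))) := by gcongr
        _ = D * ‖(x, y)‖ * N := by rw [hD]; field_simp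
        _ ≤ η * N := by gcongr)
  have hpt : ∀ u ∈ Metric.ball (1 : ℂ) r, ‖doubleSum a (x * u) (y / u)‖ₑ ^ (-(2 * c)) ≤
      ENNReal.ofReal (((2 : ℝ) ^ q) ^ (2 * c)) *
        ‖u ^ q * doubleSum a (x * u) (y / u)‖ₑ ^ (-(2 * c)) := by
    intro u hu
    have hu' : u ∈ Metric.ball (1 : ℂ) (1 / 2) :=
      Metric.ball_subset_ball (by linarith) hu
    have hle : ‖u ^ q‖ₑ ≤ ENNReal.ofReal (2 ^ q) := by
      rw [← ofReal_norm, norm_pow]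
      exact ENNReal.ofReal_le_ofReal
        (pow_le_pow_left₀ (norm_nonneg _) (bounds_of_mem_ball hu').2 q)
    have hone : 1 ≤ ENNReal.ofReal (((2 : ℝ) ^ q) ^ (2 * c)) * ‖u ^ q‖ₑ ^ (-(2 * c)) := by
      rw [← ENNReal.ofReal_rpow_of_pos (by positivity), ENNReal.rpow_neg, ← div_eq_mul_inv,
        ENNReal.le_div_iff_mul_le (Or.inr (by simp)) (Or.inr (by simp)), one_mul]
      exact ENNReal.rpow_le_rpow hle (by positivity)
    rw [enorm_mul, ENNReal.mul_rpow_of_ne_top enorm_ne_top enorm_ne_top, ← mul_assoc]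
    exact le_mul_of_one_le_left' hone
  have htotal : ∫⁻ u in Metric.ball (1 : ℂ) r, ‖doubleSum a (x * u) (y / u)‖ₑ ^ (-(2 * c)) ≤
      ENNReal.ofReal (((2 : ℝ) ^ q) ^ (2 * c)) * (ENNReal.ofReal (N ^ (-(2 * c))) * M) := by
    refine (setLIntegral_mono' measurableSet_ball hpt).trans ?_
    rw [lintegral_const_mul' _ _ ENNReal.ofReal_ne_top]
    gcongr
  have hfin : ∀ (s : ℝ) (m : ℕ), 0 < s → b * s ^ m ≤ N →
      ENNReal.ofReal (((2 : ℝ) ^ q) ^ (2 * c)) * (ENNReal.ofReal (N ^ (-(2 * c))) * M) ≤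
        ENNReal.ofReal (s ^ (-(2 * c * m))) * (ENNReal.ofReal (((2 : ℝ) ^ q) ^ (2 * c)) *
          (ENNReal.ofReal (b ^ (-(2 * c))) * M)) := by
    intro s m hs hsN
    have h1 : N ^ (-(2 * c)) ≤ s ^ (-(2 * c * m)) * b ^ (-(2 * c)) := by
      calc N ^ (-(2 * c)) ≤ (b * s ^ m) ^ (-(2 * c)) :=
            Real.rpow_le_rpow_of_nonpos (by positivity) hsN (by linarith)
        _ = s ^ (-(2 * c * m)) * b ^ (-(2 * c)) := by
            rw [Real.mul_rpow hb.le (by positivity), ← Real.rpow_natCast, ← Real.rpow_mul hs.le,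
              mul_comm]
            congr 2; ring
    calc _ ≤ ENNReal.ofReal (((2 : ℝ) ^ q) ^ (2 * c)) *
          (ENNReal.ofReal (s ^ (-(2 * c * m)) * b ^ (-(2 * c))) * M) := by gcongr
      _ = _ := by rw [ENNReal.ofReal_mul (by positivity)]; ring
  exact ⟨htotal.trans (hfin _ p hx0 hbx), htotal.trans (hfin _ q hy0 hby)⟩

/-! ### Summation over dyadic shells -/

theorem lintegral_ball_mul_norm {x₀ : ℂ} (hx₀ : x₀ ≠ 0) (r : ℝ) (f : ℂ → ℝ≥0∞) :
    ∫⁻ x in Metric.ball x₀ (r * ‖x₀‖), f x =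
      ENNReal.ofReal (‖x₀‖ ^ 2) * ∫⁻ u in Metric.ball 1 r, f (x₀ * u) := by
  have hn : 0 < ‖x₀‖ := norm_pos_iff.2 hx₀
  have hdet : LinearMap.det (LinearMap.mulLeft ℝ x₀) = ‖x₀‖ ^ 2 := by
    have h1 : LinearMap.det (LinearMap.mulLeft ℝ x₀) = Algebra.norm ℝ x₀ := rfl
    rw [h1, Algebra.norm_complex_apply, Complex.normSq_eq_norm_sq]
  have hmap : Measure.map (fun u => x₀ * u) (volume : Measure ℂ) =
      ENNReal.ofReal ((‖x₀‖ ^ 2)⁻¹) • volume := by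
    have := Measure.map_linearMap_addHaar_eq_smul_addHaar (volume : Measure ℂ)
      (f := LinearMap.mulLeft ℝ x₀) (by rw [hdet]; positivity)
    rw [hdet, abs_of_pos (by positivity)] at this
    exact this
  have hemb : MeasurableEmbedding (fun u => x₀ * u) :=
    (Homeomorph.mulLeft₀ x₀ hx₀).measurableEmbedding
  have hpre : (fun u => x₀ * u) ⁻¹' Metric.ball x₀ (r * ‖x₀‖) = Metric.ball 1 r := by
    ext u
    rw [Set.mem_preimage, mem_ball_iff_norm, mem_ball_iff_norm,
      show x₀ * u - x₀ = x₀ * (u - 1) by ring, norm_mul, mul_comm, mul_lt_mul_iff_left₀ hn]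
  rw [← hpre, ← hemb.lintegral_map, ← hemb.restrict_map, hmap, Measure.restrict_smul,
    lintegral_smul_measure, smul_eq_mul, ← mul_assoc, ← ENNReal.ofReal_mul (by positivity),
    mul_inv_cancel₀ (by positivity), ENNReal.ofReal_one, one_mul]

/-- The integral of `|F| ^ (-2 c)` for the area of the fibre `x y = t` over a dyadic shell
`r ≤ |x| ≤ 2 r`, which finitely many discs of radius comparable to `r` cover. -/
theorem exists_lintegral_shell_le (hρ : 0 < ρ)
    (hS : Summable fun k => ‖a k‖ * ρ ^ k.1 * ρ ^ k.2) {p q : ℕ} (hp : a (p, 0) ≠ 0)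
    (hq : a (0, q) ≠ 0) {c : ℝ} (hc : 0 < c) (hcp : c * p < 1) (hcq : c * q < 1) :
    ∃ R : ℝ, 0 < R ∧ ∃ M : ℝ≥0∞, M ≠ ⊤ ∧ ∀ (t : ℂ) (r : ℝ), t ≠ 0 → 0 < r → 2 * r ≤ R →
      ‖t‖ / r ≤ R →
      ∫⁻ x in {x | r ≤ ‖x‖ ∧ ‖x‖ ≤ 2 * r}, ENNReal.ofReal (1 + ‖t‖ ^ 2 / ‖x‖ ^ 4) *
        ‖doubleSum a x (t / x)‖ₑ ^ (-(2 * c)) ≤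
        M * ENNReal.ofReal ((2 * r) ^ (2 - 2 * c * p) + (‖t‖ / r) ^ (2 - 2 * c * q)) := by
  obtain ⟨δ, R, hδ0, hδ8, hR, M, hM, hball⟩ := exists_lintegral_ball_le hρ hS hp hq hc hcp hcq
  set Ann : Set ℂ := Metric.closedBall 0 2 ∩ {v | 1 ≤ ‖v‖} with hAnn
  have hcomp : IsCompact Ann := (isCompact_closedBall 0 2).inter_right
    (isClosed_le continuous_const continuous_norm)
  obtain ⟨s, hsA, hs⟩ := hcomp.elim_nhds_subcover (fun v => Metric.ball v δ)
    fun v _ => Metric.ball_mem_nhds v hδ0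
  refine ⟨R, hR, s.card * (16 * M), by finiteness, fun t r ht hr hrR htR => ?_⟩
  set w : ℂ → ℝ≥0∞ := fun x => ENNReal.ofReal (1 + ‖t‖ ^ 2 / ‖x‖ ^ 4) *
    ‖doubleSum a x (t / x)‖ₑ ^ (-(2 * c)) with hw
  have hrn : ‖(r : ℂ)‖ = r := by simp [abs_of_pos hr]
  have hr0 : (r : ℂ) ≠ 0 := by exact_mod_cast hr.ne'
  have htn : 0 < ‖t‖ := norm_pos_iff.2 ht
  have hcov : {x : ℂ | r ≤ ‖x‖ ∧ ‖x‖ ≤ 2 * r} ⊆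
      ⋃ v : s, Metric.ball ((r : ℂ) * v) (δ * ‖(r : ℂ) * v‖) := by
    rintro x ⟨hx1, hx2⟩
    have hxr : ‖x / r‖ = ‖x‖ / r := by rw [norm_div, hrn]
    have hmem : x / r ∈ Ann := by
      refine ⟨mem_closedBall_zero_iff.2 ?_, ?_⟩
      · rw [hxr, div_le_iff₀ hr]; exact hx2
      · change 1 ≤ ‖x / r‖
        rw [hxr, le_div_iff₀ hr]; linarith
    obtain ⟨v, hv, hxv⟩ := Set.mem_iUnion₂.1 (hs hmem)
    refine Set.mem_iUnion.2 ⟨⟨v, hv⟩, ?_⟩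
    simp only
    have h1 : x - r * v = r * (x / r - v) := by field_simp
    have hv1 : 1 ≤ ‖v‖ := (hsA v hv).2
    rw [mem_ball_iff_norm] at hxv ⊢
    rw [h1, norm_mul, norm_mul, hrn]
    calc r * ‖x / r - v‖ < r * δ := by gcongr
      _ ≤ δ * (r * ‖v‖) := by nlinarith [mul_pos hr hδ0]
  have hone : ∀ v ∈ s, ∫⁻ x in Metric.ball ((r : ℂ) * v) (δ * ‖(r : ℂ) * v‖), w x ≤
      16 * M * ENNReal.ofReal ((2 * r) ^ (2 - 2 * c * p) + (‖t‖ / r) ^ (2 - 2 * c * q)) := by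
    intro v hv
    have hv1 : 1 ≤ ‖v‖ := (hsA v hv).2
    have hv2 : ‖v‖ ≤ 2 := mem_closedBall_zero_iff.1 (hsA v hv).1
    set x₀ : ℂ := r * v with hx₀
    have hx₀n : ‖x₀‖ = r * ‖v‖ := by rw [hx₀, norm_mul, hrn]
    have hx₀pos : 0 < ‖x₀‖ := by rw [hx₀n]; positivity
    have hx₀ne : x₀ ≠ 0 := norm_pos_iff.1 hx₀pos
    have hx₀le : ‖x₀‖ ≤ 2 * r := by rw [hx₀n]; nlinarith
    have hy₀n : ‖t / x₀‖ = ‖t‖ / ‖x₀‖ := norm_div _ _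
    have hy₀pos : 0 < ‖t / x₀‖ := by rw [hy₀n]; positivity
    have hy₀le : ‖t / x₀‖ ≤ ‖t‖ / r := by
      rw [hy₀n]
      gcongr
      rw [hx₀n]; nlinarith
    obtain ⟨hI1, hI2⟩ := hball x₀ (t / x₀) hx₀ne (norm_pos_iff.1 hy₀pos) (hx₀le.trans hrR)
      (hy₀le.trans htR)
    set I := ∫⁻ u in Metric.ball (1 : ℂ) δ, ‖doubleSum a (x₀ * u) (t / x₀ / u)‖ₑ ^ (-(2 * c))
    have hpt : ∀ u ∈ Metric.ball (1 : ℂ) δ, w (x₀ * u) ≤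
        ENNReal.ofReal (16 * (1 + ‖t‖ ^ 2 / ‖x₀‖ ^ 4)) *
          ‖doubleSum a (x₀ * u) (t / x₀ / u)‖ₑ ^ (-(2 * c)) := by
      intro u hu
      have hu1 := (bounds_of_mem_ball (Metric.ball_subset_ball (by linarith) hu)).1
      simp only [hw]
      rw [div_div]
      gcongr
      have h16 : ‖x₀‖ ^ 4 ≤ 16 * ‖x₀ * u‖ ^ 4 := by
        rw [norm_mul x₀ u, mul_pow]
        have : (1 / 2 : ℝ) ^ 4 ≤ ‖u‖ ^ 4 := by gcongr
        nlinarith [pow_pos hx₀pos 4]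
      have hxu : 0 < ‖x₀ * u‖ := by
        rw [norm_mul]; exact mul_pos hx₀pos (by linarith)
      have h17 : ‖t‖ ^ 2 / ‖x₀ * u‖ ^ 4 ≤ 16 * (‖t‖ ^ 2 / ‖x₀‖ ^ 4) := by
        rw [← mul_div_assoc, div_le_div_iff₀ (by positivity) (by positivity)]
        nlinarith [sq_nonneg ‖t‖]
      linarith
    have harea : ‖x₀‖ ^ 2 * (16 * (1 + ‖t‖ ^ 2 / ‖x₀‖ ^ 4)) =
        16 * (‖x₀‖ ^ 2 + ‖t / x₀‖ ^ 2) := by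
      rw [hy₀n]; field_simp
    have hsplit : ∀ (y : ℝ) (m : ℕ), 0 < y →
        y ^ 2 * y ^ (-(2 * c * m)) = y ^ (2 - 2 * c * m) := by
      intro y m hy
      rw [← Real.rpow_natCast, ← Real.rpow_add hy]
      congr 1
    calc ∫⁻ x in Metric.ball x₀ (δ * ‖x₀‖), w x
        = ENNReal.ofReal (‖x₀‖ ^ 2) * ∫⁻ u in Metric.ball 1 δ, w (x₀ * u) :=
          lintegral_ball_mul_norm hx₀ne δ w
      _ ≤ ENNReal.ofReal (‖x₀‖ ^ 2) * (ENNReal.ofReal (16 * (1 + ‖t‖ ^ 2 / ‖x₀‖ ^ 4)) * I) := by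
          gcongr
          refine (setLIntegral_mono' measurableSet_ball hpt).trans ?_
          rw [lintegral_const_mul' _ _ ENNReal.ofReal_ne_top]
      _ = 16 * (ENNReal.ofReal (‖x₀‖ ^ 2) * I + ENNReal.ofReal (‖t / x₀‖ ^ 2) * I) := by
          rw [← mul_assoc, ← ENNReal.ofReal_mul (by positivity), harea,
            ENNReal.ofReal_mul (by norm_num), ENNReal.ofReal_add (by positivity) (by positivity),
            mul_assoc, add_mul]
          norm_num
      _ ≤ 16 * (ENNReal.ofReal (‖x₀‖ ^ 2) * (ENNReal.ofReal (‖x₀‖ ^ (-(2 * c * p))) * M) +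
            ENNReal.ofReal (‖t / x₀‖ ^ 2) * (ENNReal.ofReal (‖t / x₀‖ ^ (-(2 * c * q))) * M)) := by
          gcongr
      _ = 16 * M * ENNReal.ofReal
            (‖x₀‖ ^ (2 - 2 * c * p) + ‖t / x₀‖ ^ (2 - 2 * c * q)) := by
          rw [← mul_assoc (ENNReal.ofReal _), ← mul_assoc (ENNReal.ofReal _),
            ← ENNReal.ofReal_mul (by positivity), ← ENNReal.ofReal_mul (by positivity),
            hsplit _ _ hx₀pos, hsplit _ _ hy₀pos, ← add_mul,
            ← ENNReal.ofReal_add (by positivity) (by positivity)]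
          ring
      _ ≤ _ := by
          gcongr
          · linarith
          · linarith
  calc ∫⁻ x in {x | r ≤ ‖x‖ ∧ ‖x‖ ≤ 2 * r}, w x
      ≤ ∫⁻ x in ⋃ v : s, Metric.ball ((r : ℂ) * v) (δ * ‖(r : ℂ) * v‖), w x :=
        lintegral_mono_set hcov
    _ ≤ ∑ v ∈ s, ∫⁻ x in Metric.ball ((r : ℂ) * v) (δ * ‖(r : ℂ) * v‖), w x := by
        refine (lintegral_iUnion_le _ _).trans ?_
        rw [tsum_fintype, Finset.univ_eq_attach,
          Finset.sum_attach s fun v => ∫⁻ x in Metric.ball ((r : ℂ) * v) (δ * ‖(r : ℂ) * v‖), w x]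
    _ ≤ ∑ v ∈ s, _ := Finset.sum_le_sum hone
    _ = _ := by rw [Finset.sum_const, nsmul_eq_mul]; ring

/-- Uniform bound on the smooth fibres, in the coordinate `x`. The shells are dyadic in
`max |x| |y|`, so that they accumulate neither at `x = 0` nor at `y = 0`. -/
theorem exists_lintegral_fiber_le (hρ : 0 < ρ)
    (hS : Summable fun k => ‖a k‖ * ρ ^ k.1 * ρ ^ k.2) {p q : ℕ} (hp : a (p, 0) ≠ 0)
    (hq : a (0, q) ≠ 0) {c : ℝ} (hc : 0 < c) (hcp : c * p < 1) (hcq : c * q < 1) :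
    ∃ R : ℝ, 0 < R ∧ ∃ M : ℝ≥0∞, M ≠ ⊤ ∧ ∀ t : ℂ, t ≠ 0 →
      ∫⁻ x in {x | x ≠ 0 ∧ ‖x‖ ≤ R ∧ ‖t / x‖ ≤ R}, ENNReal.ofReal (1 + ‖t‖ ^ 2 / ‖x‖ ^ 4) *
        ‖doubleSum a x (t / x)‖ₑ ^ (-(2 * c)) ≤ M := by
  obtain ⟨R', hR', M, hM, hshell⟩ := exists_lintegral_shell_le hρ hS hp hq hc hcp hcq
  set R := R' / 2 with hR
  have hR0 : 0 < R := by positivity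
  have he1 : 0 < 2 - 2 * c * p := by nlinarith
  have he2 : 0 < 2 - 2 * c * q := by nlinarith
  set α : ℕ → ℝ := fun n => R * (1 / 2) ^ n with hα
  have hα0 : ∀ n, 0 < α n := fun n => by simp only [hα]; positivity
  have hαR : ∀ n, α n ≤ R := fun n =>
    mul_le_of_le_one_right hR0.le (pow_le_one₀ (by norm_num) (by norm_num))
  set B : ℕ → ℝ := fun n => (2 * α n) ^ (2 - 2 * c * p) + (2 * α n) ^ (2 - 2 * c * q) with hB
  have hB0 : ∀ n, 0 ≤ B n := fun n => by have := hα0 n; simp only [hB]; positivity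
  have hBs : Summable B := by
    have key : ∀ e : ℝ, 0 < e → Summable fun n => (2 * α n) ^ e := by
      intro e he
      have h1 : (fun n => (2 * α n) ^ e) = fun n => (2 * R) ^ e * ((1 / 2 : ℝ) ^ e) ^ n := by
        funext n
        simp only [hα]
        rw [← mul_assoc, Real.mul_rpow (by positivity) (by positivity), ← Real.rpow_natCast,
          ← Real.rpow_natCast, ← Real.rpow_mul (by norm_num), ← Real.rpow_mul (by norm_num),
          mul_comm e]
      rw [h1]
      refine (summable_geometric_of_lt_one (by positivity) ?_).mul_left _
      exact Real.rpow_lt_one (by norm_num) (by norm_num) he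
    exact (key _ he1).add (key _ he2)
  refine ⟨R, hR0, ∑' n, 2 * M * ENNReal.ofReal (B n), ?_, fun t ht => ?_⟩
  · rw [ENNReal.tsum_mul_left, ← ENNReal.ofReal_tsum_of_nonneg hB0 hBs]
    finiteness
  set w : ℂ → ℝ≥0∞ := fun x => ENNReal.ofReal (1 + ‖t‖ ^ 2 / ‖x‖ ^ 4) *
    ‖doubleSum a x (t / x)‖ₑ ^ (-(2 * c)) with hw
  have htn : 0 < ‖t‖ := norm_pos_iff.2 ht
  set A : ℕ → Set ℂ := fun n =>
    {x | x ≠ 0 ∧ α n / 2 ≤ max ‖x‖ ‖t / x‖ ∧ max ‖x‖ ‖t / x‖ ≤ α n} with hA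
  have hcov : {x | x ≠ 0 ∧ ‖x‖ ≤ R ∧ ‖t / x‖ ≤ R} ⊆ ⋃ n, A n := by
    rintro x ⟨hx, hx1, hx2⟩
    have hm0 : 0 < max ‖x‖ ‖t / x‖ / R := by
      have := norm_pos_iff.2 hx
      positivity
    have hm1 : max ‖x‖ ‖t / x‖ / R ≤ 1 := (div_le_one hR0).2 (max_le hx1 hx2)
    obtain ⟨n, hn1, hn2⟩ := exists_nat_pow_near_of_lt_one hm0 hm1
      (by norm_num : (0 : ℝ) < 1 / 2) (by norm_num)
    rw [lt_div_iff₀ hR0] at hn1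
    rw [div_le_iff₀ hR0] at hn2
    refine Set.mem_iUnion.2 ⟨n, hx, ?_, ?_⟩
    · simp only [hα]; rw [pow_succ] at hn1; linarith
    · simp only [hα]; linarith
  have hAn : ∀ n, ∫⁻ x in A n, w x ≤ 2 * M * ENNReal.ofReal (B n) := by
    intro n
    rcases (A n).eq_empty_or_nonempty with hne | ⟨x₁, hx₁, -, hx₁'⟩
    · rw [hne]; simp
    have hpos := hα0 n
    have hle := hαR n
    set α₀ := α n with hα₀
    have htα : ‖t‖ ≤ α₀ * α₀ := by
      have h1 : ‖t‖ = ‖x₁‖ * ‖t / x₁‖ := by rw [← norm_mul]; congr 1; field_simp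
      rw [h1]
      exact mul_le_mul ((le_max_left _ _).trans hx₁') ((le_max_right _ _).trans hx₁')
        (norm_nonneg _) hpos.le
    have htα' : ‖t‖ / α₀ ≤ α₀ := by rw [div_le_iff₀ hpos]; exact htα
    -- one shell for the points with `|x| ≥ |t / x|`, one for the others
    have hsub : A n ⊆ {x | α₀ / 2 ≤ ‖x‖ ∧ ‖x‖ ≤ 2 * (α₀ / 2)} ∪
        {x | ‖t‖ / α₀ ≤ ‖x‖ ∧ ‖x‖ ≤ 2 * (‖t‖ / α₀)} := by
      rintro x ⟨hx, hx1, hx2⟩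
      have hxn := norm_pos_iff.2 hx
      rcases le_total ‖t / x‖ ‖x‖ with h | h
      · rw [max_eq_left h] at hx1 hx2
        exact Or.inl ⟨hx1, by linarith⟩
      · rw [max_eq_right h, norm_div] at hx1 hx2
        refine Or.inr ⟨?_, ?_⟩
        · rw [div_le_iff₀ hxn] at hx2
          rw [div_le_iff₀ hpos]; linarith
        · rw [le_div_iff₀ hxn] at hx1
          rw [← mul_div_assoc, le_div_iff₀ hpos]; linarith
    have h1 := hshell t (α₀ / 2) ht (by positivity) (by linarith)
      (by rw [div_div_eq_mul_div, mul_comm, mul_div_assoc]; linarith)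
    have h2 := hshell t (‖t‖ / α₀) ht (by positivity) (by linarith)
      (by rw [div_div_cancel₀ htn.ne']; linarith)
    have h3 : (2 * (α₀ / 2)) ^ (2 - 2 * c * p) + (‖t‖ / (α₀ / 2)) ^ (2 - 2 * c * q) ≤ B n := by
      simp only [hB]
      gcongr
      · linarith
      · rw [div_div_eq_mul_div, mul_comm, mul_div_assoc]; linarith
    have h4 : (2 * (‖t‖ / α₀)) ^ (2 - 2 * c * p) + (‖t‖ / (‖t‖ / α₀)) ^ (2 - 2 * c * q) ≤
        B n := by
      simp only [hB]
      rw [div_div_cancel₀ htn.ne']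
      gcongr
      linarith
    calc ∫⁻ x in A n, w x ≤ _ := lintegral_mono_set hsub
      _ ≤ _ := lintegral_union_le _ _ _
      _ ≤ M * ENNReal.ofReal (B n) + M * ENNReal.ofReal (B n) :=
          add_le_add (h1.trans (by gcongr)) (h2.trans (by gcongr))
      _ = 2 * M * ENNReal.ofReal (B n) := by ring
  calc _ ≤ ∫⁻ x in ⋃ n, A n, w x := lintegral_mono_set hcov
    _ ≤ ∑' n, ∫⁻ x in A n, w x := lintegral_iUnion_le _ _
    _ ≤ _ := ENNReal.tsum_le_tsum hAn

/-! ### The area measure of the fibres -/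

/-- The area density of a holomorphic curve is the squared norm of its velocity. -/
theorem areaDensity_of_hasDerivAt {φ : ℂ → ℂ × ℂ} {v : ℂ × ℂ} {z : ℂ} (h : HasDerivAt φ v z) :
    areaDensity φ z = ‖v.1‖ ^ 2 + ‖v.2‖ ^ 2 := by
  have hfd : ∀ w : ℂ, fderiv ℝ φ z w = w • v := fun w => by
    rw [(h.hasFDerivAt.restrictScalars ℝ).fderiv]
    simp
  have h1 : metric ((1 : ℂ) • v) ((1 : ℂ) • v) = ‖v.1‖ ^ 2 + ‖v.2‖ ^ 2 := by
    simp [metric]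
  have h2 : metric (Complex.I • v) (Complex.I • v) = ‖v.1‖ ^ 2 + ‖v.2‖ ^ 2 := by
    simp only [metric, real_inner_self_eq_norm_sq, Prod.smul_fst, Prod.smul_snd, norm_smul]
    simp
  have h3 : metric ((1 : ℂ) • v) (Complex.I • v) = 0 := by
    simp [metric, Complex.inner]
    ring
  rw [areaDensity, hfd, hfd, h1, h2, h3, zero_pow two_ne_zero, sub_zero,
    Real.sqrt_mul_self (by positivity)]

theorem areaMeasure_eq_map {φ : ℂ → ℂ × ℂ} {D : ℂ → ℝ} (h : ∀ z, z ≠ 0 → areaDensity φ z = D z) :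
    areaMeasure φ = ((volume : Measure ℂ).withDensity fun z => ENNReal.ofReal (D z)).map φ := by
  have h0 : (volume : Measure ℂ).restrict {0}ᶜ = volume :=
    Measure.restrict_eq_self_of_ae_mem (Measure.ae_ne volume 0)
  have hae : (fun z => ENNReal.ofReal (areaDensity φ z)) =ᵐ[volume]
      fun z => ENNReal.ofReal (D z) := by
    filter_upwards [Measure.ae_ne volume 0] with z hz
    rw [h z hz]
  rw [areaMeasure, h0, withDensity_congr_ae hae]

theorem areaMeasure_smooth (t : ℂ) : areaMeasure (fun x => (x, t / x)) =
    ((volume : Measure ℂ).withDensity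
      fun x => ENNReal.ofReal (1 + ‖t‖ ^ 2 / ‖x‖ ^ 4)).map fun x => (x, t / x) := by
  refine areaMeasure_eq_map fun z hz => ?_
  have hd : HasDerivAt (fun x : ℂ => t / x) (-t / z ^ 2) z := by
    simpa using (hasDerivAt_const z t).fun_div (hasDerivAt_id' z) hz
  rw [areaDensity_of_hasDerivAt ((hasDerivAt_id' z).prodMk hd)]
  simp only [norm_one, norm_div, norm_neg, norm_pow, div_pow, ← pow_mul, one_pow]

theorem areaMeasure_axis_fst : areaMeasure (fun x => (x, 0)) =
    (volume : Measure ℂ).map fun x => (x, 0) := by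
  rw [areaMeasure_eq_map (D := fun _ => 1)]
  · simp
  · intro z _
    rw [areaDensity_of_hasDerivAt ((hasDerivAt_id' z).prodMk (hasDerivAt_const z (0 : ℂ)))]
    simp

theorem areaMeasure_axis_snd : areaMeasure (fun y => (0, y)) =
    (volume : Measure ℂ).map fun y => (0, y) := by
  rw [areaMeasure_eq_map (D := fun _ => 1)]
  · simp
  · intro z _
    rw [areaDensity_of_hasDerivAt ((hasDerivAt_const z (0 : ℂ)).prodMk (hasDerivAt_id' z))]
    simp

theorem fiberVolume_zero : fiberVolume 0 = ((volume : Measure ℂ).map fun x => (x, (0 : ℂ))) +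
    (volume : Measure ℂ).map fun y => ((0 : ℂ), y) := by
  rw [fiberVolume, if_pos rfl, areaMeasure_axis_fst, areaMeasure_axis_snd]

theorem measurableSet_fiber (t : ℂ) : MeasurableSet (fiber t) :=
  (isClosed_eq (by fun_prop) continuous_const : IsClosed {p : ℂ × ℂ | p.1 * p.2 = t}).measurableSet

theorem isOpen_polydisc (R : ℝ) : IsOpen (polydisc R) :=
  (isOpen_lt continuous_fst.norm continuous_const).inter
    (isOpen_lt continuous_snd.norm continuous_const)

theorem negPowIntegral_smooth_le {t : ℂ} (ht : t ≠ 0) (R : ℝ) (f : ℂ × ℂ → ℂ) (c : ℝ) :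
    negPowIntegral (fiberVolume t) (fiber t ∩ polydisc R) f c ≤
      ∫⁻ x in {x | x ≠ 0 ∧ ‖x‖ ≤ R ∧ ‖t / x‖ ≤ R}, ENNReal.ofReal (1 + ‖t‖ ^ 2 / ‖x‖ ^ 4) *
        ‖f (x, t / x)‖ₑ ^ (-(2 * c)) := by
  have hφ : Measurable fun x : ℂ => (x, t / x) := by fun_prop
  have hS : MeasurableSet (fiber t ∩ polydisc R) :=
    (measurableSet_fiber t).inter (isOpen_polydisc R).measurableSet
  rw [negPowIntegral, fiberVolume, if_neg ht, areaMeasure_smooth, Measure.restrict_map hφ hS,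
    restrict_withDensity (hφ hS)]
  refine (lintegral_map_le _ _).trans ?_
  refine (lintegral_withDensity_le_lintegral_mul _ (by fun_prop) _).trans ?_
  refine lintegral_mono_set ?_
  rintro x ⟨hx1, hx2, hx3⟩
  refine ⟨?_, hx2.le, hx3.le⟩
  rintro rfl
  exact ht (by simpa [fiber] using hx1.symm)

theorem isometry_mk_zero : Isometry fun x : ℂ => (x, (0 : ℂ)) :=
  Isometry.of_dist_eq fun x y => by simp [Prod.dist_eq]

theorem isometry_zero_mk : Isometry fun y : ℂ => ((0 : ℂ), y) :=
  Isometry.of_dist_eq fun x y => by simp [Prod.dist_eq]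

/-- Finiteness of the integral on the singular fibre gives finiteness on both axes. -/
theorem exists_lintegral_axes_lt_top {V : Set (ℂ × ℂ)} (hV : IsOpen V) (h0 : 0 ∈ V)
    {f : ℂ × ℂ → ℂ} {c : ℝ} (h : negPowIntegral (fiberVolume 0) (fiber 0 ∩ V) f c < ⊤) :
    ∃ r : ℝ, 0 < r ∧ ∫⁻ x in Metric.ball (0 : ℂ) r, ‖f (x, 0)‖ₑ ^ (-(2 * c)) < ⊤ ∧
      ∫⁻ y in Metric.ball (0 : ℂ) r, ‖f (0, y)‖ₑ ^ (-(2 * c)) < ⊤ := by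
  obtain ⟨r, hr, hball⟩ := Metric.isOpen_iff.1 hV 0 h0
  rw [negPowIntegral, fiberVolume_zero, Measure.restrict_add, lintegral_add_measure,
    ENNReal.add_lt_top] at h
  refine ⟨r, hr, ?_, ?_⟩
  · have h1 := h.1
    have hemb := isometry_mk_zero.isClosedEmbedding.measurableEmbedding
    rw [hemb.restrict_map, hemb.lintegral_map] at h1
    refine (lintegral_mono_set fun x hx => ?_).trans_lt h1
    refine ⟨by simp [fiber], hball ?_⟩
    simpa [Prod.dist_eq, Prod.norm_def, hr] using hx
  · have h1 := h.2
    have hemb := isometry_zero_mk.isClosedEmbedding.measurableEmbedding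
    rw [hemb.restrict_map, hemb.lintegral_map] at h1
    refine (lintegral_mono_set fun x hx => ?_).trans_lt h1
    refine ⟨by simp [fiber], hball ?_⟩
    simpa [Prod.dist_eq, Prod.norm_def, hr] using hx

theorem fiberVolume_zero_polydisc_lt_top (R : ℝ) : fiberVolume 0 (polydisc R) < ⊤ := by
  have hfin : volume (Metric.ball (0 : ℂ) R) < ⊤ := by rw [Complex.volume_ball]; finiteness
  rw [fiberVolume_zero, Measure.add_apply,
    isometry_mk_zero.isClosedEmbedding.measurableEmbedding.map_apply,
    isometry_zero_mk.isClosedEmbedding.measurableEmbedding.map_apply]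
  refine ENNReal.add_lt_top.2 ⟨(measure_mono fun x hx => ?_).trans_lt hfin,
    (measure_mono fun x hx => ?_).trans_lt hfin⟩
  · exact mem_ball_zero_iff.2 hx.1
  · exact mem_ball_zero_iff.2 hx.2

theorem negPowIntegral_zero_lt_top {V : Set (ℂ × ℂ)} {f : ℂ × ℂ → ℂ} {c c' : ℝ} (hc : 0 < c)
    (hcc' : c ≤ c') (h : negPowIntegral (fiberVolume 0) (fiber 0 ∩ V) f c' < ⊤) {R : ℝ}
    (hR : polydisc R ⊆ V) :
    negPowIntegral (fiberVolume 0) (fiber 0 ∩ polydisc R) f c < ⊤ := by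
  have hpt : ∀ e : ℝ≥0∞, e ^ (-(2 * c)) ≤ 1 + e ^ (-(2 * c')) := by
    intro e
    rcases le_total 1 e with he | he
    · exact le_add_right (ENNReal.rpow_le_one_of_one_le_of_neg he (by linarith))
    · exact le_add_left (ENNReal.rpow_le_rpow_of_exponent_ge he (by linarith))
  calc negPowIntegral (fiberVolume 0) (fiber 0 ∩ polydisc R) f c
      ≤ ∫⁻ p in fiber 0 ∩ polydisc R, (1 + ‖f p‖ₑ ^ (-(2 * c'))) ∂fiberVolume 0 :=
        lintegral_mono fun p => hpt _
    _ = fiberVolume 0 (fiber 0 ∩ polydisc R) +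
          ∫⁻ p in fiber 0 ∩ polydisc R, ‖f p‖ₑ ^ (-(2 * c')) ∂fiberVolume 0 := by
        rw [lintegral_add_left measurable_const, lintegral_one, Measure.restrict_apply_univ]
    _ < ⊤ := by
        refine ENNReal.add_lt_top.2 ⟨?_, ?_⟩
        · exact (measure_mono Set.inter_subset_right).trans_lt (fiberVolume_zero_polydisc_lt_top R)
        · exact (lintegral_mono_set (Set.inter_subset_inter_right _ hR)).trans_lt h

/-! ### Orders of vanishing on the axes -/

theorem lintegral_ball_norm_rpow_neg_two {r : ℝ} (hr : 0 < r) :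
    ∫⁻ z in Metric.ball (0 : ℂ) r, ENNReal.ofReal (‖z‖ ^ (-2 : ℝ)) = ⊤ := by
  by_contra hne
  set g : ℝ → ℝ := (Set.Ioo 0 r).indicator fun y => y ^ (-2 : ℝ) with hg
  have hgm : Measurable g := by
    refine Measurable.indicator ?_ measurableSet_Ioo
    fun_prop
  have hg0 : ∀ y, 0 ≤ g y := fun y =>
    Set.indicator_nonneg (fun y hy => Real.rpow_nonneg hy.1.le _) y
  have hint : Integrable (fun z : ℂ => g ‖z‖) volume := by
    refine ⟨(hgm.comp measurable_norm).aestronglyMeasurable, ?_⟩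
    rw [hasFiniteIntegral_iff_ofReal (Eventually.of_forall fun z => hg0 _)]
    refine lt_of_le_of_lt ?_ (lt_top_iff_ne_top.2 hne)
    rw [← lintegral_indicator measurableSet_ball]
    refine lintegral_mono fun z => ?_
    by_cases hz : z ∈ Metric.ball (0 : ℂ) r
    · rw [Set.indicator_of_mem hz]
      exact ENNReal.ofReal_le_ofReal
        (Set.indicator_le_self' (fun _ _ => Real.rpow_nonneg (norm_nonneg z) _) _)
    · have : ‖z‖ ∉ Set.Ioo 0 r := fun h => hz (mem_ball_zero_iff.2 h.2)
      simp only [hg, Set.indicator_of_notMem this, ENNReal.ofReal_zero]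
      exact bot_le
  rw [integrable_fun_norm_addHaar, Complex.finrank_real_complex] at hint
  have h1 : IntegrableOn (fun y : ℝ => y ^ (-1 : ℝ)) (Set.Ioo 0 r) volume := by
    refine ((hint.mono_set Set.Ioo_subset_Ioi_self).congr_fun (fun y hy => ?_) measurableSet_Ioo)
    simp only [hg, Set.indicator_of_mem hy, smul_eq_mul, Nat.reduceSub, pow_one]
    rw [show (-1 : ℝ) = 1 + (-2) by norm_num, Real.rpow_add hy.1, Real.rpow_one]
  exact lt_irrefl _ ((intervalIntegral.integrableOn_Ioo_rpow_iff hr).1 h1)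

/-- Integrability of `|F(x, 0)| ^ (-2 c)` near `0` forces `F(x, 0)` to vanish at `0` to some finite
order below `1 / c`: otherwise the integrand dominates a multiple of `|x| ^ (-2)`. -/
theorem exists_coeff_ne_zero (hρ : 0 < ρ) (hS : Summable fun k => ‖a k‖ * ρ ^ k.1 * ρ ^ k.2)
    {c r : ℝ} (hc : 0 < c) (hr : 0 < r)
    (h : ∫⁻ x in Metric.ball (0 : ℂ) r, ‖doubleSum a x 0‖ₑ ^ (-(2 * c)) < ⊤) :
    ∃ p : ℕ, a (p, 0) ≠ 0 ∧ c * p < 1 := by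
  by_contra! hno
  set A := ∑' k, ‖a k‖ * ρ ^ k.1 * ρ ^ k.2 with hA
  have hA0 : 0 ≤ A := tsum_nonneg fun k => by positivity
  have hle : ∀ x : ℂ, ‖x‖ ≤ ρ → ‖doubleSum a x 0‖ ≤ (A + 1) * (‖x‖ / ρ) ^ (1 / c) := by
    intro x hx
    have hx0 : 0 ≤ ‖x‖ / ρ := by positivity
    have hx1 : ‖x‖ / ρ ≤ 1 := (div_le_one hρ).2 hx
    have hb : ∀ k, ‖a k * x ^ k.1 * 0 ^ k.2‖ ≤
        (‖x‖ / ρ) ^ (1 / c) * (‖a k‖ * ρ ^ k.1 * ρ ^ k.2) := by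
      rintro ⟨m, n⟩
      by_cases hn : n = 0
      · subst hn
        by_cases ha : a (m, 0) = 0
        · simp [ha]
        · have hm := hno m ha
          have hpow : (‖x‖ / ρ) ^ m ≤ (‖x‖ / ρ) ^ (1 / c) := by
            rw [← Real.rpow_natCast]
            refine Real.rpow_le_rpow_of_exponent_ge' hx0 hx1 (by positivity) ?_
            rw [div_le_iff₀ hc]; linarith
          simp only [pow_zero, mul_one, norm_mul, norm_pow]
          calc ‖a (m, 0)‖ * ‖x‖ ^ m = (‖x‖ / ρ) ^ m * (‖a (m, 0)‖ * ρ ^ m) := by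
                rw [div_pow]; field_simp
            _ ≤ _ := by gcongr
      · simp only [zero_pow hn, mul_zero, norm_zero]
        positivity
    refine (tsum_of_norm_bounded (hS.mul_left _).hasSum hb).trans ?_
    rw [tsum_mul_left, mul_comm]
    gcongr
    linarith
  set K : ℝ := (A + 1) ^ (-(2 * c)) * ρ ^ (2 : ℝ) with hK
  have hK0 : 0 < K := by positivity
  have hlow : ∀ x ∈ Metric.ball (0 : ℂ) (min r ρ), ENNReal.ofReal K *
      ENNReal.ofReal (‖x‖ ^ (-2 : ℝ)) ≤ ‖doubleSum a x 0‖ₑ ^ (-(2 * c)) := by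
    intro x hx
    have hx' : ‖x‖ < min r ρ := mem_ball_zero_iff.1 hx
    rcases eq_or_ne x 0 with rfl | hx0
    · simp
    have hxn := norm_pos_iff.2 hx0
    have hb := hle x (hx'.le.trans (min_le_right _ _))
    have hbp : 0 < (A + 1) * (‖x‖ / ρ) ^ (1 / c) := by positivity
    have heq : ((A + 1) * (‖x‖ / ρ) ^ (1 / c)) ^ (-(2 * c)) = K * ‖x‖ ^ (-2 : ℝ) := by
      rw [Real.mul_rpow (by positivity) (by positivity), ← Real.rpow_mul (by positivity),
        show 1 / c * -(2 * c) = -2 by field_simp, Real.div_rpow hxn.le hρ.le,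
        Real.rpow_neg hρ.le 2, hK]
      field_simp
    rw [← ENNReal.ofReal_mul hK0.le, ← heq, ← ENNReal.ofReal_rpow_of_pos hbp, ENNReal.rpow_neg,
      ENNReal.rpow_neg, ENNReal.inv_le_inv]
    refine ENNReal.rpow_le_rpow ?_ (by positivity)
    rw [← ofReal_norm]
    exact ENNReal.ofReal_le_ofReal hb
  have hlt : ∫⁻ x in Metric.ball (0 : ℂ) (min r ρ), ENNReal.ofReal K *
      ENNReal.ofReal (‖x‖ ^ (-2 : ℝ)) < ⊤ :=
    (setLIntegral_mono' measurableSet_ball hlow).trans_lt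
      ((lintegral_mono_set (Metric.ball_subset_ball (min_le_left _ _))).trans_lt h)
  rw [lintegral_const_mul' _ _ ENNReal.ofReal_ne_top,
    lintegral_ball_norm_rpow_neg_two (lt_min hr hρ),
    ENNReal.mul_top (ENNReal.ofReal_pos.2 hK0).ne'] at hlt
  exact lt_irrefl _ hlt

theorem doubleSum_swap (a : ℕ × ℕ → ℂ) (x y : ℂ) :
    doubleSum (a ∘ Prod.swap) y x = doubleSum a x y := by
  rw [doubleSum, doubleSum, ← (Equiv.prodComm ℕ ℕ).tsum_eq]
  refine tsum_congr fun k => ?_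
  simp only [Function.comp_apply, Equiv.prodComm_apply, Prod.swap_swap, Prod.fst_swap,
    Prod.snd_swap]
  ring

/-! ### Convergent power series in two variables -/

/-- Exponents of monomials in two variables as pairs of natural numbers. -/
noncomputable def exponentEquiv : (Fin 2 →₀ ℕ) ≃ ℕ × ℕ :=
  Finsupp.equivFunOnFinite.trans (finTwoArrowEquiv ℕ)

/-- The coefficients of a formal power series in two variables, indexed by pairs. -/
noncomputable def pairCoeff (F : MvPowerSeries (Fin 2) ℂ) (k : ℕ × ℕ) : ℂ :=
  MvPowerSeries.coeff (exponentEquiv.symm k) F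

theorem term_eq (F : MvPowerSeries (Fin 2) ℂ) (p : ℂ × ℂ) :
    term F p = (fun k => pairCoeff F k * p.1 ^ k.1 * p.2 ^ k.2) ∘ exponentEquiv := by
  funext m
  simp only [Function.comp_apply, pairCoeff, Equiv.symm_apply_apply]
  rfl

theorem evalAt_eq_doubleSum (F : MvPowerSeries (Fin 2) ℂ) (p : ℂ × ℂ) :
    evalAt F p = doubleSum (pairCoeff F) p.1 p.2 := by
  rw [evalAt, term_eq]
  exact exponentEquiv.tsum_eq fun k => pairCoeff F k * p.1 ^ k.1 * p.2 ^ k.2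

/-- Convergence near the origin gives absolute convergence on a closed polydisc. -/
theorem IsConvergent.exists_summable {F : MvPowerSeries (Fin 2) ℂ} (hF : IsConvergent F) :
    ∃ ρ : ℝ, 0 < ρ ∧ Summable fun k => ‖pairCoeff F k‖ * ρ ^ k.1 * ρ ^ k.2 := by
  obtain ⟨ε, hε, h⟩ := Metric.eventually_nhds_iff_ball.1 hF
  have hn : ‖((ε / 2 : ℝ) : ℂ)‖ = ε / 2 := by
    rw [Complex.norm_real, Real.norm_of_nonneg (by positivity)]
  have hs := h (((ε / 2 : ℝ) : ℂ), ((ε / 2 : ℝ) : ℂ)) (by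
    rw [mem_ball_zero_iff, Prod.norm_def]
    simp only [hn, max_self]
    linarith)
  rw [term_eq, exponentEquiv.summable_iff] at hs
  refine ⟨ε / 2, by positivity, hs.norm.congr fun k => ?_⟩
  simp only [norm_mul, norm_pow, hn]

end FiberIntegral

open FiberIntegral in
theorem theorem4 (F : MvPowerSeries (Fin 2) ℂ) (hF : FiberIntegral.IsConvergent F)
    (c : ℝ) (hc : 0 < c)
    (hc0 : ENNReal.ofReal c <
      FiberIntegral.singularityExponent 0 (FiberIntegral.evalAt F) 0) :
    ∃ R : ℝ, 0 < R ∧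
      (∀ p ∈ FiberIntegral.polydisc R, Summable (FiberIntegral.term F p)) ∧
      ∃ δ : ℝ, 0 < δ ∧ ∃ M : ℝ, 0 < M ∧
        ∀ t : ℂ, ‖t‖ ≤ δ →
          FiberIntegral.negPowIntegral (FiberIntegral.fiberVolume t)
            (FiberIntegral.fiber t ∩ FiberIntegral.polydisc R)
            (FiberIntegral.evalAt F) c ≤ ENNReal.ofReal M := by
  obtain ⟨_, ⟨c', hc'0, rfl, V, hV, h0V, hfin⟩, hcc'⟩ := lt_sSup_iff.1 hc0
  have hlt : c < c' := (ENNReal.ofReal_lt_ofReal_iff_of_nonneg hc.le).1 hcc'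
  obtain ⟨ρ, hρ, hS⟩ := hF.exists_summable
  obtain ⟨r, hr, hr1, hr2⟩ := exists_lintegral_axes_lt_top hV h0V hfin
  simp only [evalAt_eq_doubleSum] at hr1 hr2
  obtain ⟨p, hp, hcp⟩ := exists_coeff_ne_zero hρ hS (hc.trans hlt) hr hr1
  simp only [← doubleSum_swap (pairCoeff F) 0] at hr2
  obtain ⟨q, hq, hcq⟩ := exists_coeff_ne_zero hρ (summable_swap hS) (hc.trans hlt) hr hr2
  have hcp' : c * p < 1 := lt_of_le_of_lt (by gcongr) hcp
  have hcq' : c * q < 1 := lt_of_le_of_lt (by gcongr) hcq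
  obtain ⟨R₁, hR₁, M, hM, hbound⟩ :=
    exists_lintegral_fiber_le hρ hS hp (by simpa using hq) hc hcp' hcq'
  obtain ⟨R₂, hR₂, hball⟩ := Metric.isOpen_iff.1 hV 0 h0V
  set R := min (min R₁ R₂) ρ with hR
  have hRR₁ : R ≤ R₁ := (min_le_left _ _).trans (min_le_left _ _)
  have hRR₂ : R ≤ R₂ := (min_le_left _ _).trans (min_le_right _ _)
  have hRρ : R ≤ ρ := min_le_right _ _
  have hpoly : polydisc R ⊆ V := fun z hz => hball <| by
    rw [mem_ball_zero_iff, Prod.norm_def]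
    exact (max_lt hz.1 hz.2).trans_le hRR₂
  have hzero := negPowIntegral_zero_lt_top hc hlt.le hfin hpoly
  set M₀ := negPowIntegral (fiberVolume 0) (fiber 0 ∩ polydisc R) (evalAt F) c with hM₀
  refine ⟨R, lt_min (lt_min hR₁ hR₂) hρ, fun z hz => ?_, 1, one_pos, (M + M₀).toReal + 1,
    by positivity, fun t _ => ?_⟩
  · rw [term_eq, exponentEquiv.summable_iff]
    exact summable_coeff_mul_pow hS (hz.1.le.trans hRρ) (hz.2.le.trans hRρ)
  -- `M` serves the smooth fibres, `M₀` the singular one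
  · have hle : M + M₀ ≤ ENNReal.ofReal ((M + M₀).toReal + 1) := by
      refine (ENNReal.le_ofReal_iff_toReal_le (ENNReal.add_ne_top.2 ⟨hM, hzero.ne⟩)
        (by positivity)).2 (by linarith)
    refine le_trans ?_ hle
    by_cases ht : t = 0
    · rw [ht]; exact le_add_self
    · refine le_add_right ((negPowIntegral_smooth_le ht R _ c).trans ?_)
      simp only [evalAt_eq_doubleSum]
      refine (lintegral_mono_set ?_).trans (hbound t ht)
      exact fun x hx => ⟨hx.1, hx.2.1.trans hRR₁, hx.2.2.trans hRR₁⟩
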